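/- All manifolds are finite-dimensional, smooth, connected, Hausdorff and second countable; $\mathfrak X(M)$ is the Lie algebra of smooth vector fields on $M$. Let $M$ have dimension $2n+1$, $n\ge 0$, and let $\eta$ be a contact form on $M$, i.e. a smooth one-form such that $\eta\wedge(\mathrm d\eta)^n$ is a volume form. Its Reeb vector field $R\in\mathfrak X(M)$ is given by $i_R\mathrm d\eta=0$, $i_R\eta=1$. A vector field $Y$ on $M$ is contact Hamiltonian with Hamiltonian function $h\in C^\infty(M)$ if $i_Y\mathrm d\eta=\mathrm dh-(Rh)\eta$ and $i_Y\eta=-h$. A $t$-dependent vector field is a family $X=(X_t)_{t\in\mathbb R}$ in $\mathfrak X(M)$; $V^X$ denotes the smallest Lie subalgebra of $\mathfrak X(M)$ containing all $X_t$, and $X$ is a Lie system if $\dim V^X<\infty$. $(M,\eta,X)$ is a conservative contact Lie system if $X$ is a Lie system, every $Y\in V^X$ is contact Hamiltonian, and the Hamiltonian functions $h$ of the elements of $V^X$ satisfy $Rh=0$. A Lie--Hamilton system relative to a symplectic form $\Omega$ on $N$ is a Lie system $Y$ on $N$ for which there is a finite-dimensional Lie algebra $V\subset\mathfrak X(N)$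 containing all $Y_t$ and such that for every $Z\in V$ there is $f\in C^\infty(N)$ with $i_Z\Omega=\mathrm df$. **Proposition.** Let $(M,\eta,X)$ be a conservative contact Lie system with Reeb vector field $R$, let $M/R$ be the space of (maximal) integral curves of $R$ with the quotient topology, and let $\pi:M\to M/R$ be the canonical projection. Suppose that $M/R$ is a manifold, i.e. that it is Hausdorff and carries a smooth structure for which $\pi$ is a smooth submersion. Then: 1. there is a unique two-form $\Omega$ on $M/R$ such that $\pi^*\Omega=\mathrm d\eta$, and $\Omega$ is a symplectic form; 2. there is a unique $t$-dependent vector field $\pi_*X$ on $M/R$ such that $\mathrm T_x\pi\,(X_t(x))=(\pi_*X)_t(\pi(x))$ for all $t\in\mathbb R$ and $x\in M$; if $X$ is smooth as a map $\mathbb R\times M\to \mathrm TM$, then $\pi_*X$ is smooth as a map $\mathbb R\times M/R\to\mathrm T(M/R)$; 3. $\pi_*X$ is a Lie--Hamilton system relative to $\Omega$. -/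

import Mathlib

open scoped Manifold ContDiff Topology

noncomputable section

namespace ContactLie

/-! ### Exterior algebra -/

section Wedge

variable {V : Type*} [AddCommGroup V] [Module ℝ V]

/-- The wedge product of real alternating forms, as the sum over all shuffles. -/
def wedge {k l : ℕ} (a : V [⋀^Fin k]→ₗ[ℝ] ℝ) (b : V [⋀^Fin l]→ₗ[ℝ] ℝ) :
    V [⋀^Fin (k + l)]→ₗ[ℝ] ℝ :=
  ((LinearMap.mul' ℝ ℝ).compAlternatingMap (a.domCoprod b)).domDomCongr finSumFinEquiv

/-- The `n`-fold wedge power `α ∧ ⋯ ∧ α` of an alternating 2-form. -/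
def wedgePow (α : V [⋀^Fin 2]→ₗ[ℝ] ℝ) : (n : ℕ) → V [⋀^Fin (2 * n)]→ₗ[ℝ] ℝ
  | 0 => AlternatingMap.constOfIsEmpty ℝ V (Fin 0) 1
  | n + 1 => wedge (wedgePow α n) α

end Wedge

/-! ### Vector fields and differential forms on a boundaryless manifold modelled on `E` -/

section Basics

variable (E : Type*) [NormedAddCommGroup E] [NormedSpace ℝ E]
  (M : Type*) [TopologicalSpace M] [ChartedSpace E M]

/-- Smooth vector fields on `M`. -/
abbrev VectorFields [IsManifold 𝓘(ℝ, E) ∞ M] : Type _ :=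
  Cₛ^∞⟮𝓘(ℝ, E); E, (TangentSpace 𝓘(ℝ, E) : M → Type _)⟯

/-- Differential `k`-forms on `M`, without regularity; see `IsSmoothForm`. -/
abbrev Form (k : ℕ) : Type _ :=
  (x : M) → (TangentSpace 𝓘(ℝ, E) x) [⋀^Fin k]→L[ℝ] ℝ

variable {E M}

/-- The coordinate expression of a form in the preferred chart at `x₀`, that is, its pullback under
the inverse of this chart. -/
def Form.inChart {k : ℕ} (α : Form E M k) (x₀ : M) : E → E [⋀^Fin k]→L[ℝ] ℝ :=
  fun y => (α ((extChartAt 𝓘(ℝ, E) x₀).symm y)).compContinuousLinearMap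
    (mfderiv 𝓘(ℝ, E) 𝓘(ℝ, E) (extChartAt 𝓘(ℝ, E) x₀).symm y)

/-- A form is smooth if all its coordinate expressions are smooth. -/
def IsSmoothForm {k : ℕ} (α : Form E M k) : Prop :=
  ∀ x₀ : M, ContDiffOn ℝ ∞ (α.inChart x₀) (extChartAt 𝓘(ℝ, E) x₀).target

/-- The exterior derivative: at `x`, take the exterior derivative of the coordinate expression in
the preferred chart at `x` and pull it back by this chart. -/
def Form.d {k : ℕ} (α : Form E M k) : Form E M (k + 1) :=
  fun x => (extDeriv (α.inChart x) (extChartAt 𝓘(ℝ, E) x x)).compContinuousLinearMap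
    (mfderiv 𝓘(ℝ, E) 𝓘(ℝ, E) (extChartAt 𝓘(ℝ, E) x) x)

/-- The pullback of a form by a map. -/
def Form.pullback {F : Type*} [NormedAddCommGroup F] [NormedSpace ℝ F]
    {N : Type*} [TopologicalSpace N] [ChartedSpace F N] {k : ℕ}
    (f : M → N) (α : Form F N k) : Form E M k :=
  fun x => (α (f x)).compContinuousLinearMap (mfderiv 𝓘(ℝ, E) 𝓘(ℝ, F) f x)

/-- The differential at `x` of a real function, applied to a tangent vector. -/
def dfun (h : M → ℝ) (x : M) (v : TangentSpace 𝓘(ℝ, E) x) : ℝ :=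
  mfderiv 𝓘(ℝ, E) 𝓘(ℝ, ℝ) h x v

/-- Smooth real functions. -/
def IsSmoothFun (h : M → ℝ) : Prop := ContMDiff 𝓘(ℝ, E) 𝓘(ℝ, ℝ) ∞ h

end Basics

/-! ### The Lie algebra of vector fields -/

section LieAlgebra

variable {E : Type*} [NormedAddCommGroup E] [NormedSpace ℝ E] [CompleteSpace E]
  {M : Type*} [TopologicalSpace M] [ChartedSpace E M] [IsManifold 𝓘(ℝ, E) ∞ M]

/-- The bracket of two smooth vector fields is Mathlib's Lie bracket. -/
instance : Bracket (VectorFields E M) (VectorFields E M) where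
  bracket X Y := ⟨VectorField.mlieBracket 𝓘(ℝ, E) X Y, by
    intro x
    have h0 : (((⊤ : ℕ∞) : WithTop ℕ∞) + 1) = ∞ := rfl
    have : IsManifold 𝓘(ℝ, E) (((⊤ : ℕ∞) : WithTop ℕ∞) + 1) M := by
      rw [h0]; infer_instance
    have : IsManifold 𝓘(ℝ, E) (minSmoothness ℝ 2) M :=
      IsManifold.of_le (n := ∞) (by
        rw [minSmoothness_of_isRCLikeNormedField]; exact WithTop.coe_le_coe.2 le_top)
    exact ContMDiffAt.mlieBracket_vectorField (m := ⊤) (n := ⊤) (X.contMDiff x) (Y.contMDiff x)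
      (by rw [minSmoothness_of_isRCLikeNormedField, h0])⟩

theorem bracket_apply (X Y : VectorFields E M) (x : M) :
    (⁅X, Y⁆ : VectorFields E M) x = VectorField.mlieBracket 𝓘(ℝ, E) X Y x := rfl

instance : LieRing (VectorFields E M) where
  add_lie X Y Z := by
    ext x
    exact VectorField.mlieBracket_add_left (X.mdifferentiable x) (Y.mdifferentiable x)
  lie_add X Y Z := by
    ext x
    exact VectorField.mlieBracket_add_right (Y.mdifferentiable x) (Z.mdifferentiable x)
  lie_self X := by
    ext x
    simp [bracket_apply]
  leibniz_lie X Y Z := by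
    ext x
    have : IsManifold 𝓘(ℝ, E) (minSmoothness ℝ 3) M :=
      IsManifold.of_le (n := ∞) (by
        rw [minSmoothness_of_isRCLikeNormedField]; exact WithTop.coe_le_coe.2 le_top)
    have h2 : minSmoothness ℝ 2 ≤ ∞ := by
      rw [minSmoothness_of_isRCLikeNormedField]; exact WithTop.coe_le_coe.2 le_top
    exact VectorField.leibniz_identity_mlieBracket_apply ((X.contMDiff x).of_le h2)
      ((Y.contMDiff x).of_le h2) ((Z.contMDiff x).of_le h2)

instance : LieAlgebra ℝ (VectorFields E M) where
  lie_smul c X Y := by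
    ext x
    exact VectorField.mlieBracket_const_smul_right (Y.mdifferentiable x)

/-- The smallest Lie algebra `V^X` of a `t`-dependent vector field. -/
def smallestLieAlgebra (X : ℝ → VectorFields E M) : LieSubalgebra ℝ (VectorFields E M) :=
  LieSubalgebra.lieSpan ℝ (VectorFields E M) (Set.range X)

/-- A Lie system is a `t`-dependent vector field whose smallest Lie algebra is
finite-dimensional. -/
def IsLieSystem (X : ℝ → VectorFields E M) : Prop :=
  FiniteDimensional ℝ (smallestLieAlgebra X)

/-- A `t`-dependent vector field is smooth if it is smooth as a map `ℝ × M → TM`. -/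
def IsSmoothInTime (X : ℝ → VectorFields E M) : Prop :=
  ContMDiff (𝓘(ℝ, ℝ).prod 𝓘(ℝ, E)) (𝓘(ℝ, E).prod 𝓘(ℝ, E)) ∞
    (fun p : ℝ × M => (⟨p.2, X p.1 p.2⟩ : TangentBundle 𝓘(ℝ, E) M))

end LieAlgebra

/-! ### Contact manifolds and contact Lie systems -/

section Contact

variable {E : Type*} [NormedAddCommGroup E] [NormedSpace ℝ E]
  {M : Type*} [TopologicalSpace M] [ChartedSpace E M]

/-- `η` is a contact form on the `(2n+1)`-dimensional manifold `M`: a smooth one-form such that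
`η ∧ (dη)^n` is a volume form. -/
structure IsContactForm (n : ℕ) (η : Form E M 1) : Prop where
  finrank_eq : Module.finrank ℝ E = 2 * n + 1
  smooth : IsSmoothForm η
  volume : ∀ x, wedge (η x).toAlternatingMap (wedgePow (η.d x).toAlternatingMap n) ≠ 0

variable [IsManifold 𝓘(ℝ, E) ∞ M]

/-- `R` is the Reeb vector field of `η`: `i(R) dη = 0` and `i(R) η = 1`. -/
structure IsReebField (η : Form E M 1) (R : VectorFields E M) : Prop where
  contract_d : ∀ x v, η.d x ![R x, v] = 0
  contract : ∀ x, η x ![R x] = 1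

/-- `X` is the contact Hamiltonian vector field of `h`: `i(X) dη = dh - (R h) η` and
`i(X) η = -h`. -/
structure IsContactHamiltonian (η : Form E M 1) (R X : VectorFields E M) (h : M → ℝ) : Prop where
  smooth : IsSmoothFun (E := E) h
  contract_d : ∀ x v, η.d x ![X x, v] = dfun h x v - dfun h x (R x) * η x ![v]
  contract : ∀ x, η x ![X x] = -h x

variable [CompleteSpace E]

/-- `(M, η, X)` is a contact Lie system: a Lie system whose smallest Lie algebra consists of
contact Hamiltonian vector fields. Here `R` is the Reeb vector field of `η`. -/
structure IsContactLieSystem (n : ℕ) (η : Form E M 1) (R : VectorFields E M)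
    (X : ℝ → VectorFields E M) : Prop where
  contact : IsContactForm n η
  reeb : IsReebField η R
  lie : IsLieSystem X
  hamiltonian : ∀ Y ∈ smallestLieAlgebra X, ∃ h : M → ℝ, IsContactHamiltonian η R Y h

/-- A contact Lie system is conservative if the Hamiltonian functions of the elements of `V^X`
are first integrals of the Reeb vector field. -/
structure IsConservativeContactLieSystem (n : ℕ) (η : Form E M 1) (R : VectorFields E M)
    (X : ℝ → VectorFields E M) : Prop extends IsContactLieSystem n η R X where
  conservative : ∀ Y ∈ smallestLieAlgebra X, ∀ h : M → ℝ, IsContactHamiltonian η R Y h →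
    ∀ x, dfun h x (R x) = 0

end Contact

/-! ### Symplectic forms and Lie-Hamilton systems -/

section Symplectic

variable {F : Type*} [NormedAddCommGroup F] [NormedSpace ℝ F]
  {N : Type*} [TopologicalSpace N] [ChartedSpace F N]

/-- A symplectic form is a smooth, closed and nondegenerate two-form. -/
structure IsSymplecticForm (Ω : Form F N 2) : Prop where
  smooth : IsSmoothForm Ω
  closed : ∀ x, Ω.d x = 0
  nondegenerate : ∀ x v, (∀ w, Ω x ![v, w] = 0) → v = 0

variable [IsManifold 𝓘(ℝ, F) ∞ N]

/-- `Y` is a Hamiltonian vector field relative to `Ω`: `i(Y) Ω = df` for some smooth `f`. -/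
def IsHamiltonianField (Ω : Form F N 2) (Y : VectorFields F N) : Prop :=
  ∃ f : N → ℝ, IsSmoothFun (E := F) f ∧ ∀ x v, Ω x ![Y x, v] = dfun f x v

variable [CompleteSpace F]

/-- `(N, Ω, Y)` is a Lie-Hamilton system relative to the symplectic form `Ω`: `Y` is a Lie system
admitting a Vessiot-Guldberg Lie algebra, that is, a finite-dimensional Lie algebra containing all
the `Y t`, of Hamiltonian vector fields. -/
structure IsLieHamiltonSystem (Ω : Form F N 2) (Y : ℝ → VectorFields F N) : Prop where
  symplectic : IsSymplecticForm Ω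
  lie : IsLieSystem Y
  hamiltonian : ∃ V : LieSubalgebra ℝ (VectorFields F N), FiniteDimensional ℝ V ∧
    (∀ t, Y t ∈ V) ∧ ∀ Z ∈ V, IsHamiltonianField Ω Z

end Symplectic

/-! ### The space of integral curves of a vector field -/

section Orbits

variable {E : Type*} [NormedAddCommGroup E] [NormedSpace ℝ E] [CompleteSpace E]
  {M : Type*} [TopologicalSpace M] [T2Space M] [ChartedSpace E M] [IsManifold 𝓘(ℝ, E) ∞ M]

/-- Two points are related if some integral curve of `R`, defined on an open interval, passes
through both. -/
def SameIntegralCurve (R : VectorFields E M) (x y : M) : Prop :=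
  ∃ (γ : ℝ → M) (a b s t : ℝ), IsMIntegralCurveOn (I := 𝓘(ℝ, E)) γ (fun z => R z) (Set.Ioo a b) ∧
    s ∈ Set.Ioo a b ∧ t ∈ Set.Ioo a b ∧ γ s = x ∧ γ t = y

theorem sameIntegralCurve_equivalence (R : VectorFields E M) :
    Equivalence (SameIntegralCurve R) where
  refl x := by
    have h1 : (1 : WithTop ℕ∞) ≤ ∞ := by exact_mod_cast le_top
    have : IsManifold 𝓘(ℝ, E) 1 M := IsManifold.of_le (n := ∞) h1
    obtain ⟨γ, hx, hγ⟩ := exists_isMIntegralCurveAt_of_contMDiffAt_boundaryless 0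
      ((R.contMDiff x).of_le h1)
    obtain ⟨ε, hε, h⟩ := isMIntegralCurveAt_iff'.mp hγ
    rw [Real.ball_eq_Ioo] at h
    exact ⟨γ, 0 - ε, 0 + ε, 0, 0, h, by simp [hε], by simp [hε], hx, hx⟩
  symm := by
    rintro x y ⟨γ, a, b, s, t, h, hs, ht, hx, hy⟩
    exact ⟨γ, a, b, t, s, h, ht, hs, hy, hx⟩
  trans := by
    rintro x y z ⟨γ, a, b, s, t, h, hs, ht, hx, hy⟩ ⟨γ', a', b', s', t', h', hs', ht', hy', hz⟩
    have h1 : (1 : WithTop ℕ∞) ≤ ∞ := by exact_mod_cast le_top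
    have : IsManifold 𝓘(ℝ, E) 1 M := IsManifold.of_le (n := ∞) h1
    have hR := R.contMDiff.of_le h1
    -- translate the second curve so that both pass through `y` at time `t`
    have h'' := h'.comp_add (s' - t)
    have hset : {r : ℝ | r + (s' - t) ∈ Set.Ioo a' b'} =
        Set.Ioo (a' - (s' - t)) (b' - (s' - t)) := by
      ext r
      simp only [Set.mem_ofPred_eq, Set.mem_Ioo]
      constructor <;> rintro ⟨h3, h4⟩ <;> constructor <;> linarith
    rw [hset] at h''
    have hmem : t ∈ Set.Ioo (a' - (s' - t)) (b' - (s' - t)) := by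
      constructor <;> linarith [hs'.1, hs'.2]
    have hmem' : t' - (s' - t) ∈ Set.Ioo (a' - (s' - t)) (b' - (s' - t)) := by
      constructor <;> linarith [ht'.1, ht'.2]
    have hag : γ t = (γ' ∘ (· + (s' - t))) t := by simp [hy, hy']
    have hp := isMIntegralCurveOn_piecewise hR h h'' ⟨ht, hmem⟩ hag
    have he := eqOn_piecewise_of_isMIntegralCurveOn_Ioo hR h h'' ⟨ht, hmem⟩ hag
    rw [Set.Ioo_union_Ioo' (by linarith [hmem.1, ht.2]) (by linarith [hmem.2, ht.1])] at hp
    refine ⟨_, _, _, s, t' - (s' - t), hp, ?_, ?_, ?_, ?_⟩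
    · exact ⟨min_lt_of_left_lt hs.1, lt_max_of_lt_left hs.2⟩
    · exact ⟨min_lt_of_right_lt hmem'.1, lt_max_of_lt_right hmem'.2⟩
    · rw [Set.piecewise_eq_of_mem _ _ _ hs, hx]
    · rw [he hmem']
      simp [hz]

/-- The equivalence relation on `M` whose classes are the (maximal) integral curves of `R`. -/
def integralCurveSetoid (R : VectorFields E M) : Setoid M :=
  ⟨SameIntegralCurve R, sameIntegralCurve_equivalence R⟩

/-- The space `M/R` of integral curves of `R`, with the quotient topology. -/
abbrev IntegralCurveSpace (R : VectorFields E M) : Type _ := Quotient (integralCurveSetoid R)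

/-- The canonical projection `M → M/R`. -/
def projection (R : VectorFields E M) : M → IntegralCurveSpace R :=
  Quotient.mk (integralCurveSetoid R)

end Orbits

/-- The vector field `Y` on `N` is the projection `π_* X` of the vector field `X` on `M`. -/
def IsProjectionOf {E : Type*} [NormedAddCommGroup E] [NormedSpace ℝ E]
    {M : Type*} [TopologicalSpace M] [ChartedSpace E M] [IsManifold 𝓘(ℝ, E) ∞ M]
    {F : Type*} [NormedAddCommGroup F] [NormedSpace ℝ F]
    {N : Type*} [TopologicalSpace N] [ChartedSpace F N] [IsManifold 𝓘(ℝ, F) ∞ N]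
    (π : M → N) (X : VectorFields E M) (Y : VectorFields F N) : Prop :=
  ∀ x, mfderiv 𝓘(ℝ, E) 𝓘(ℝ, F) π x (X x) = Y (π x)

end ContactLie

end

open ContactLie

/-! The crux is that the kernel of Tπ is exactly the line spanned by R. It contains R because π is
constant along integral curves. Conversely, in a chart where π is the projection F × K → F, a fibre
contains an open piece of K; but a fibre is one integral curve, a countable union of smooth arcs, so
its Hausdorff dimension is at most one and dim K ≤ 1 (`SubmersionChart.finrank_le_one`). As R never
vanishes, the kernel is its span.

Since dη annihilates R, it factors through Tπ at each point x and gives a two-form B x on the model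
space F. In a submersion chart dη is closed and annihilates the K-directions, so its coefficients do
not vary along K: B is locally constant along fibres, hence constant on each integral curve by
connectedness, and defines Ω (`exists_form`). For a local section σ of π one has Ω = σ^*π^*Ω =
d(σ^*η), so Ω is smooth and closed. It is nondegenerate because the contact condition makes R span
ker dη (`IsContactForm.eq_smul_reeb`) and Tπ annihilates R.

If Z ∈ V^X has Hamiltonian function f with Rf = 0, then f descends to g and Ω(Tπ Z, ·) = dg.
Nondegeneracy makes Tπ Z depend only on the point below, so Z projects, and its projection is
Hamiltonian. Projection is linear and respects brackets (`IsProjectionOf.bracket`), so the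
projections of V^X form a finite-dimensional Lie algebra of Hamiltonian fields containing π_*X. -/

noncomputable section

namespace ContactLie

/-! ### Kernels of alternating forms -/

section WedgeContraction

variable {V : Type*} [AddCommGroup V] [Module ℝ V]

/-- If `v` is in the kernel of two alternating forms, then it is in the kernel of their wedge. -/
theorem wedge_apply_eq_zero {k l : ℕ} {a : V [⋀^Fin k]→ₗ[ℝ] ℝ} {b : V [⋀^Fin l]→ₗ[ℝ] ℝ} {v : V}
    (ha : ∀ w i, w i = v → a w = 0) (hb : ∀ w i, w i = v → b w = 0)
    (w : Fin (k + l) → V) (i : Fin (k + l)) (hi : w i = v) : wedge a b w = 0 := by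
  simp only [wedge, AlternatingMap.domDomCongr_apply, LinearMap.compAlternatingMap_apply]
  have hsum : a.domCoprod b (w ∘ finSumFinEquiv) =
      ∑ σ, AlternatingMap.domCoprod.summand a b σ (w ∘ finSumFinEquiv) := by
    rw [← AlternatingMap.coe_multilinearMap, AlternatingMap.domCoprod_coe, sum_apply]
  rw [hsum, map_sum]
  refine Finset.sum_eq_zero fun σ _ => ?_
  induction σ using Quotient.inductionOn' with
  | _ σ =>
    rw [AlternatingMap.domCoprod.summand_mk'']
    simp only [smul_apply, MultilinearMap.domDomCongr_apply,
      MultilinearMap.domCoprod_apply]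
    -- In each shuffle term `v` lands in a slot of `a` or in a slot of `b`, and that factor
    -- vanishes.
    obtain ⟨j, hj⟩ : ∃ j, finSumFinEquiv (σ j) = i := ⟨σ.symm (finSumFinEquiv.symm i), by simp⟩
    rcases j with j | j
    · have : a (fun i => w (finSumFinEquiv (σ (Sum.inl i)))) = 0 := ha _ j (by rw [hj, hi])
      simp [this]
    · have : b (fun i => w (finSumFinEquiv (σ (Sum.inr i)))) = 0 := hb _ j (by rw [hj, hi])
      simp [this]

theorem wedgePow_apply_eq_zero {α : V [⋀^Fin 2]→ₗ[ℝ] ℝ} {v : V}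
    (h : ∀ w i, w i = v → α w = 0) (n : ℕ) (w : Fin (2 * n) → V) (i : Fin (2 * n))
    (hi : w i = v) : wedgePow α n w = 0 := by
  induction n with
  | zero => exact i.elim0
  | succ n ih => exact wedge_apply_eq_zero ih h w i hi

/-- A top-degree alternating form with a nonzero vector in its kernel vanishes. -/
theorem alternatingMap_eq_zero_of_kernel [FiniteDimensional ℝ V] {m : ℕ}
    (hm : Module.finrank ℝ V = m) (f : V [⋀^Fin m]→ₗ[ℝ] ℝ) {v : V} (hv : v ≠ 0)
    (h : ∀ w i, w i = v → f w = 0) : f = 0 := by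
  by_contra hf
  obtain ⟨w, hw⟩ : ∃ w, f w ≠ 0 := by
    by_contra! h0
    exact hf (AlternatingMap.ext h0)
  have hli : LinearIndependent ℝ w := by
    by_contra hd
    exact hw (f.map_linearDependent w hd)
  let B := basisOfLinearIndependentOfCardEqFinrank' w hli (by simp [hm])
  have hB : ⇑B = w := by simp [B]
  obtain ⟨i, hi⟩ : ∃ i, B.repr v i ≠ 0 := by
    by_contra! h0
    exact hv (B.repr.map_eq_zero_iff.1 (Finsupp.ext h0))
  -- Expand `v` in the basis `w`, with `i` a nonzero coordinate: putting `v` in slot `i` multiplies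
  -- `f w` by that coordinate, as all other terms repeat a vector.
  have h1 : f (Function.update w i v) = 0 := h _ i (by simp)
  rw [← B.sum_repr v, hB, f.map_update_sum] at h1
  rw [Finset.sum_eq_single i] at h1
  · rw [f.map_update_smul, Function.update_eq_self] at h1
    exact (mul_ne_zero hi hw) h1
  · intro j _ hj
    rw [f.map_update_smul, f.map_update_self w hj.symm, smul_zero]
  · simp

end WedgeContraction

theorem form_one_apply_eq_zero {V : Type*} [NormedAddCommGroup V] [NormedSpace ℝ V]
    {α : V [⋀^Fin 1]→L[ℝ] ℝ} {v : V} (h : α ![v] = 0) (w : Fin 1 → V) (i : Fin 1)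
    (hi : w i = v) : α w = 0 := by
  rw [← h]; congr 1; ext j; rw [Subsingleton.elim j i, hi]; simp [Subsingleton.elim i 0]

theorem form_two_swap {V : Type*} [NormedAddCommGroup V] [NormedSpace ℝ V]
    (α : V [⋀^Fin 2]→L[ℝ] ℝ) (v w : V) : α ![v, w] = - α ![w, v] := by
  have h : α (![w, v] ∘ Equiv.swap 0 1) = - α ![w, v] :=
    α.toAlternatingMap.map_swap ![w, v] (i := 0) (j := 1) (by simp)
  rw [← h]; congr 1; ext j; fin_cases j <;> simp

theorem form_two_apply_eq_zero {V : Type*} [NormedAddCommGroup V] [NormedSpace ℝ V]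
    {α : V [⋀^Fin 2]→L[ℝ] ℝ} {v : V} (h : ∀ u, α ![v, u] = 0) (w : Fin 2 → V) (i : Fin 2)
    (hi : w i = v) : α w = 0 := by
  have hw : w = ![w 0, w 1] := by ext j; fin_cases j <;> simp
  fin_cases i
  · rw [hw]; simp at hi; rw [hi]; exact h _
  · rw [hw, form_two_swap]; simp at hi; rw [hi, h, neg_zero]

/-! ### The kernel of dη -/

section Kernel

variable {E : Type*} [NormedAddCommGroup E] [NormedSpace ℝ E] [FiniteDimensional ℝ E]
  {M : Type*} [TopologicalSpace M] [ChartedSpace E M]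

/-- On a contact manifold, `ker η ∩ ker dη = 0`. -/
theorem IsContactForm.eq_zero {n : ℕ} {η : Form E M 1} (hη : IsContactForm n η) {x : M}
    {v : TangentSpace 𝓘(ℝ, E) x} (h1 : η x ![v] = 0) (h2 : ∀ w, η.d x ![v, w] = 0) : v = 0 := by
  by_contra hv
  refine hη.volume x ?_
  have : FiniteDimensional ℝ (TangentSpace 𝓘(ℝ, E) x) := inferInstanceAs (FiniteDimensional ℝ E)
  refine alternatingMap_eq_zero_of_kernel ?_ _ hv ?_
  · rw [add_comm]; exact hη.finrank_eq
  · exact wedge_apply_eq_zero (fun w i hi => form_one_apply_eq_zero (V := E) h1 w i hi)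
      (wedgePow_apply_eq_zero (fun w i hi => form_two_apply_eq_zero (V := E) h2 w i hi) n)

/-- The kernel of `dη` is spanned by the Reeb vector field. -/
theorem IsContactForm.eq_smul_reeb [IsManifold 𝓘(ℝ, E) ∞ M] {n : ℕ} {η : Form E M 1}
    (hη : IsContactForm n η)
    {R : VectorFields E M} (hR : IsReebField η R) {x : M} {v : TangentSpace 𝓘(ℝ, E) x}
    (h2 : ∀ w, η.d x ![v, w] = 0) : v = η x ![v] • R x := by
  have hsub : ∀ u : TangentSpace 𝓘(ℝ, E) x, ∀ c : ℝ,
      η x ![u - c • R x] = η x ![u] - c * η x ![R x] := by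
    intro u c
    have h3 := (η x).map_update_sub ![u] 0 u (c • R x)
    have h4 := (η x).map_update_smul ![u] 0 c (R x)
    simp only [Matrix.vecCons, Fin.update_cons_zero] at h3 h4 ⊢
    rw [h3, h4, smul_eq_mul]
  have h2sub : ∀ w, ∀ c : ℝ,
      η.d x ![v - c • R x, w] = η.d x ![v, w] - c * η.d x ![R x, w] := by
    intro w c
    have h3 := (η.d x).map_update_sub ![v, w] 0 v (c • R x)
    have h4 := (η.d x).map_update_smul ![v, w] 0 c (R x)
    simp only [Matrix.vecCons, Fin.update_cons_zero] at h3 h4 ⊢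
    rw [h3, h4, smul_eq_mul]
  rw [← sub_eq_zero]
  refine hη.eq_zero ?_ fun w => ?_
  · rw [hsub, hR.contract, mul_one, sub_self]
  · rw [h2sub, h2, hR.contract_d, mul_zero, sub_zero]

omit [FiniteDimensional ℝ E] in
theorem IsReebField.ne_zero [IsManifold 𝓘(ℝ, E) ∞ M] {η : Form E M 1}
    {R : VectorFields E M} (hR : IsReebField η R) (x : M) : R x ≠ 0 := by
  intro h
  have h1 := hR.contract x
  rw [h, (η x).map_coord_zero (m := ![0]) 0 (by simp)] at h1
  exact zero_ne_one h1

end Kernel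

/-! ### Smoothness, pullback and exterior derivative -/

section Pullback

/-- One-forms are isometrically linear functionals, and under this identification pullback is
composition of continuous linear maps. Degree one suffices: two-forms are only met as exterior
derivatives of such pullbacks. -/
theorem contDiffAt_oneForm_pullback {V E : Type*} [NormedAddCommGroup V] [NormedSpace ℝ V]
    [NormedAddCommGroup E] [NormedSpace ℝ E] {β : E → E [⋀^Fin 1]→L[ℝ] ℝ} {f : V → E} {z : V}
    (hβ : ContDiffAt ℝ ∞ β (f z)) (hf : ContDiffAt ℝ ∞ f z) :
    ContDiffAt ℝ ∞ (fun y => (β (f y)).compContinuousLinearMap (fderiv ℝ f y)) z := by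
  have hfd : ContDiffAt ℝ ∞ (fderiv ℝ f) z := hf.fderiv_right (m := ∞) le_rfl
  have h1 : (fun y => (β (f y)).compContinuousLinearMap (fderiv ℝ f y)) = fun y =>
      ContinuousAlternatingMap.ofSubsingletonLIE (𝕜 := ℝ) (E := V) (F := ℝ) (0 : Fin 1)
        (((ContinuousAlternatingMap.ofSubsingletonLIE (𝕜 := ℝ) (E := E) (F := ℝ) (0 : Fin 1)).symm (β (f y))).comp
          (fderiv ℝ f y)) := by
    funext y
    obtain ⟨L, hL⟩ := (ContinuousAlternatingMap.ofSubsingletonLIE (𝕜 := ℝ) (E := E) (F := ℝ) (0 : Fin 1)).surjective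
      (β (f y))
    rw [← hL, LinearIsometryEquiv.symm_apply_apply]
    ext v
    simp
  rw [h1]
  refine (ContinuousAlternatingMap.ofSubsingletonLIE (𝕜 := ℝ) (E := V) (F := ℝ) (0 : Fin 1)).contDiff.contDiffAt.comp z ?_
  refine ContDiffAt.clm_comp ?_ hfd
  exact (LinearIsometryEquiv.contDiff _).contDiffAt.comp z (hβ.comp z hf)

theorem contDiffAt_extDeriv {V : Type*} [NormedAddCommGroup V] [NormedSpace ℝ V] {k : ℕ}
    {β : V → V [⋀^Fin k]→L[ℝ] ℝ} {z : V} (hβ : ContDiffAt ℝ ∞ β z) :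
    ContDiffAt ℝ ∞ (extDeriv β) z := by
  have h : extDeriv β =
      ContinuousAlternatingMap.alternatizeUncurryFinCLM ℝ V ℝ ∘ fderiv ℝ β := by
    funext y
    simp [extDeriv]
  rw [h]
  exact (ContinuousAlternatingMap.alternatizeUncurryFinCLM ℝ V ℝ (n := k)).contDiff.contDiffAt.comp z
    (hβ.fderiv_right (m := ∞) le_rfl)

variable {E : Type*} [NormedAddCommGroup E] [NormedSpace ℝ E]
  {M : Type*} [TopologicalSpace M] [ChartedSpace E M] [IsManifold 𝓘(ℝ, E) ∞ M]
  {V : Type*} [NormedAddCommGroup V] [NormedSpace ℝ V]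

omit [IsManifold 𝓘(ℝ, E) ∞ M] in
-- All tangent spaces are `E` by definition, so vectors move between equal base points without a
-- cast.
theorem Form.apply_congr {k : ℕ} (α : Form E M k) {x y : M} (h : x = y) (u : Fin k → E) :
    (α x : E [⋀^Fin k]→L[ℝ] ℝ) u = (α y : E [⋀^Fin k]→L[ℝ] ℝ) u := by
  subst h; rfl

/-- In the preferred chart at `x`, the pullback of a form by a map is the pullback of the
coordinate expression. -/
theorem pullback_eq_inChart {k : ℕ} (α : Form E M k) {g : V → M} {z : V} {x : M}
    (hg : MDifferentiableAt 𝓘(ℝ, V) 𝓘(ℝ, E) g z) (hx : g z ∈ (chartAt E x).source) :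
    Form.pullback g α z = (α.inChart x (extChartAt 𝓘(ℝ, E) x (g z))).compContinuousLinearMap
      (fderiv ℝ (extChartAt 𝓘(ℝ, E) x ∘ g) z) := by
  have h1 : (1 : WithTop ℕ∞) ≤ ∞ := by exact_mod_cast le_top
  have : IsManifold 𝓘(ℝ, E) 1 M := IsManifold.of_le (n := ∞) h1
  have hx' : g z ∈ (extChartAt 𝓘(ℝ, E) x).source := by simpa using hx
  have hleft : (extChartAt 𝓘(ℝ, E) x).symm (extChartAt 𝓘(ℝ, E) x (g z)) = g z :=
    (extChartAt 𝓘(ℝ, E) x).left_inv hx'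
  have hd : mfderiv 𝓘(ℝ, E) 𝓘(ℝ, E) (extChartAt 𝓘(ℝ, E) x) (g z) ∘L
      mfderiv 𝓘(ℝ, V) 𝓘(ℝ, E) g z = fderiv ℝ (extChartAt 𝓘(ℝ, E) x ∘ g) z := by
    rw [← mfderiv_eq_fderiv, mfderiv_comp z (mdifferentiableAt_extChartAt hx) hg]
  have hinv := mfderivWithin_extChartAt_symm_comp_mfderiv_extChartAt' (I := 𝓘(ℝ, E)) hx'
  rw [modelWithCornersSelf_coe, Set.range_id, mfderivWithin_univ] at hinv
  rw [← hd]
  ext v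
  change (α (g z) : E [⋀^Fin k]→L[ℝ] ℝ) (fun i => mfderiv 𝓘(ℝ, V) 𝓘(ℝ, E) g z (v i)) =
    (α ((extChartAt 𝓘(ℝ, E) x).symm (extChartAt 𝓘(ℝ, E) x (g z))) : E [⋀^Fin k]→L[ℝ] ℝ)
      (fun i => mfderiv 𝓘(ℝ, E) 𝓘(ℝ, E) (extChartAt 𝓘(ℝ, E) x).symm
        (extChartAt 𝓘(ℝ, E) x (g z)) (mfderiv 𝓘(ℝ, E) 𝓘(ℝ, E) (extChartAt 𝓘(ℝ, E) x) (g z)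
          (mfderiv 𝓘(ℝ, V) 𝓘(ℝ, E) g z (v i))))
  refine Eq.trans ?_ (Form.apply_congr α hleft _).symm
  congr 1
  funext i
  exact (DFunLike.congr_fun hinv (mfderiv 𝓘(ℝ, V) 𝓘(ℝ, E) g z (v i))).symm

/-- A single chart, the one at `g z`, serves for all points near `z`, so the formula can be
differentiated. -/
theorem eventually_pullback_eq_inChart {k : ℕ} (α : Form E M k) {g : V → M} {z : V}
    (hg : ContMDiffAt 𝓘(ℝ, V) 𝓘(ℝ, E) ∞ g z) :
    Form.pullback g α =ᶠ[𝓝 z] fun y =>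
      (α.inChart (g z) ((extChartAt 𝓘(ℝ, E) (g z) ∘ g) y)).compContinuousLinearMap
        (fderiv ℝ (extChartAt 𝓘(ℝ, E) (g z) ∘ g) y) := by
  have h1 : (1 : WithTop ℕ∞) ≤ ∞ := by exact_mod_cast le_top
  have : IsManifold 𝓘(ℝ, E) 1 M := IsManifold.of_le (n := ∞) h1
  have h3 : ∀ᶠ y in 𝓝 z, ContMDiffAt 𝓘(ℝ, V) 𝓘(ℝ, E) 1 g y :=
    (contMDiffAt_iff_contMDiffAt_nhds (by simp)).1 (hg.of_le h1)
  have h2 : ∀ᶠ y in 𝓝 z, g y ∈ (chartAt E (g z)).source :=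
    hg.continuousAt.eventually_mem (chart_source_mem_nhds E (g z))
  filter_upwards [h3, h2] with y hy hy'
  exact pullback_eq_inChart α (hy.mdifferentiableAt one_ne_zero) hy'

omit [IsManifold 𝓘(ℝ, E) ∞ M] in
theorem contDiffAt_extChartAt_comp {g : V → M} {z : V}
    (hg : ContMDiffAt 𝓘(ℝ, V) 𝓘(ℝ, E) ∞ g z) :
    ContDiffAt ℝ ∞ (extChartAt 𝓘(ℝ, E) (g z) ∘ g) z := by
  rw [← contMDiffAt_iff_contDiffAt]
  exact contMDiffAt_extChartAt.comp z hg

omit [IsManifold 𝓘(ℝ, E) ∞ M] in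
theorem IsSmoothForm.contDiffAt {k : ℕ} {α : Form E M k} (hα : IsSmoothForm α) (x : M) :
    ContDiffAt ℝ ∞ (α.inChart x) (extChartAt 𝓘(ℝ, E) x x) :=
  (hα x).contDiffAt (extChartAt_target_mem_nhds x)

/-- The pullback of a smooth one-form by a smooth map is smooth. -/
theorem IsSmoothForm.contDiffAt_pullback {α : Form E M 1} (hα : IsSmoothForm α) {g : V → M} {z : V}
    (hg : ContMDiffAt 𝓘(ℝ, V) 𝓘(ℝ, E) ∞ g z) :
    ContDiffAt ℝ ∞ (F := V [⋀^Fin 1]→L[ℝ] ℝ) (Form.pullback g α) z :=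
  (contDiffAt_oneForm_pullback (f := extChartAt 𝓘(ℝ, E) (g z) ∘ g) (hα.contDiffAt (g z))
    (contDiffAt_extChartAt_comp hg)).congr_of_eventuallyEq (eventually_pullback_eq_inChart α hg)

/-- The exterior derivative commutes with pullback by a smooth map. -/
theorem IsSmoothForm.extDeriv_pullback {k : ℕ} {α : Form E M k} (hα : IsSmoothForm α) {g : V → M}
    {z : V} (hg : ContMDiffAt 𝓘(ℝ, V) 𝓘(ℝ, E) ∞ g z) :
    extDeriv (E := V) (F := ℝ) (Form.pullback g α) z = Form.pullback g α.d z := by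
  have h1 : (1 : WithTop ℕ∞) ≤ ∞ := by exact_mod_cast le_top
  have : IsManifold 𝓘(ℝ, E) 1 M := IsManifold.of_le (n := ∞) h1
  have h2 : minSmoothness ℝ 2 ≤ ∞ := by
    rw [minSmoothness_of_isRCLikeNormedField]; exact WithTop.coe_le_coe.2 le_top
  have hgd := hg.mdifferentiableAt (by simp)
  -- Naturality of d between vector spaces applies to the chart expression; `Form.d` at `g z` uses
  -- this same chart, so the two sides then agree by definition.
  rw [(eventually_pullback_eq_inChart α hg).extDeriv_eq,
    _root_.extDeriv_pullback (f := extChartAt 𝓘(ℝ, E) (g z) ∘ g)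
    ((hα.contDiffAt (g z)).differentiableAt (by simp)) (contDiffAt_extChartAt_comp hg) h2,
    ← mfderiv_eq_fderiv,
    mfderiv_comp z (mdifferentiableAt_extChartAt (mem_chart_source E (g z))) hgd]
  rfl

end Pullback

/-! ### Charts adapted to a submersion -/

section Submersion

theorem mfderiv_congr_base {E : Type*} [NormedAddCommGroup E] [NormedSpace ℝ E]
    {M : Type*} [TopologicalSpace M] [ChartedSpace E M]
    {F : Type*} [NormedAddCommGroup F] [NormedSpace ℝ F]
    {N : Type*} [TopologicalSpace N] [ChartedSpace F N] (f : M → N) {x y : M} (h : x = y) (v : E) :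
    (mfderiv 𝓘(ℝ, E) 𝓘(ℝ, F) f x v : F) = mfderiv 𝓘(ℝ, E) 𝓘(ℝ, F) f y v := by
  subst h; rfl

/-- A pair of smooth charts in which `π` is a linear projection `F × K → F`. -/
structure SubmersionChart {E : Type*} [NormedAddCommGroup E] [NormedSpace ℝ E]
    {M : Type*} [TopologicalSpace M] [ChartedSpace E M]
    {F : Type*} [NormedAddCommGroup F] [NormedSpace ℝ F]
    {N : Type*} [TopologicalSpace N] [ChartedSpace F N]
    (K : Type*) [NormedAddCommGroup K] [NormedSpace ℝ K] (π : M → N) where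
  /-- The chart of the source. -/
  dom : OpenPartialHomeomorph M (F × K)
  /-- The chart of the target. -/
  cod : OpenPartialHomeomorph N F
  contMDiffOn_dom : ContMDiffOn 𝓘(ℝ, E) 𝓘(ℝ, F × K) ∞ dom dom.source
  contMDiffOn_dom_symm : ContMDiffOn 𝓘(ℝ, F × K) 𝓘(ℝ, E) ∞ dom.symm dom.target
  contMDiffOn_cod : ContMDiffOn 𝓘(ℝ, F) 𝓘(ℝ, F) ∞ cod cod.source
  contMDiffOn_cod_symm : ContMDiffOn 𝓘(ℝ, F) 𝓘(ℝ, F) ∞ cod.symm cod.target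
  mapsTo : ∀ x ∈ dom.source, π x ∈ cod.source
  cod_apply : ∀ x ∈ dom.source, cod (π x) = (dom x).1

variable {E : Type*} [NormedAddCommGroup E] [NormedSpace ℝ E]
  {M : Type*} [TopologicalSpace M] [ChartedSpace E M]
  {F : Type*} [NormedAddCommGroup F] [NormedSpace ℝ F]
  {N : Type*} [TopologicalSpace N] [ChartedSpace F N]
  {K : Type*} [NormedAddCommGroup K] [NormedSpace ℝ K] {π : M → N}

theorem exists_submersionChart
    (hπ : Manifold.IsSubmersionOfComplement K 𝓘(ℝ, E) 𝓘(ℝ, F) ∞ π) (x : M) :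
    ∃ c : SubmersionChart (E := E) (F := F) K π, x ∈ c.dom.source := by
  have h := hπ x
  refine ⟨⟨h.domChart.trans h.equiv.toHomeomorph.toOpenPartialHomeomorph, h.codChart,
    ?_, ?_, ?_, ?_, ?_, ?_⟩, ?_⟩
  · have h1 := contMDiffOn_of_mem_maximalAtlas h.domChart_mem_maximalAtlas
    have h2 := h.equiv.contDiff (n := ∞)
    simpa using h2.contMDiff.comp_contMDiffOn h1
  · have h1 := contMDiffOn_symm_of_mem_maximalAtlas h.domChart_mem_maximalAtlas
    have h2 := h.equiv.symm.contDiff (n := ∞)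
    simpa using h1.comp h2.contMDiff.contMDiffOn fun z hz => by simpa using hz
  · exact contMDiffOn_of_mem_maximalAtlas h.codChart_mem_maximalAtlas
  · exact contMDiffOn_symm_of_mem_maximalAtlas h.codChart_mem_maximalAtlas
  · intro x hx
    exact h.source_subset_preimage_source (by simpa using hx)
  · intro x hx
    have hx' : x ∈ h.domChart.source := by simpa using hx
    have hx'' : h.domChart x ∈ (h.domChart.extend 𝓘(ℝ, E)).target := by simp [hx']
    have h1 := h.writtenInCharts hx''
    simpa [hx'] using h1
  · simpa using h.mem_domChart_source

namespace SubmersionChart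

variable (c : SubmersionChart (E := E) (F := F) K π)

theorem apply_symm {w : F × K} (hw : w ∈ c.dom.target) : π (c.dom.symm w) = c.cod.symm w.1 := by
  have h := c.dom.map_target hw
  rw [← c.cod.left_inv (c.mapsTo _ h), c.cod_apply _ h, c.dom.right_inv hw]

theorem apply_eq_iff {x y : M} (hx : x ∈ c.dom.source) (hy : y ∈ c.dom.source) :
    π x = π y ↔ (c.dom x).1 = (c.dom y).1 := by
  rw [← c.cod_apply _ hx, ← c.cod_apply _ hy]
  exact ⟨fun h => by rw [h], fun h => c.cod.injOn (c.mapsTo _ hx) (c.mapsTo _ hy) h⟩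

theorem contMDiffAt_dom {x : M} (hx : x ∈ c.dom.source) :
    ContMDiffAt 𝓘(ℝ, E) 𝓘(ℝ, F × K) ∞ c.dom x :=
  c.contMDiffOn_dom.contMDiffAt (c.dom.open_source.mem_nhds hx)

theorem contMDiffAt_dom_symm {w : F × K} (hw : w ∈ c.dom.target) :
    ContMDiffAt 𝓘(ℝ, F × K) 𝓘(ℝ, E) ∞ c.dom.symm w :=
  c.contMDiffOn_dom_symm.contMDiffAt (c.dom.open_target.mem_nhds hw)

theorem contMDiffAt_cod {y : N} (hy : y ∈ c.cod.source) :
    ContMDiffAt 𝓘(ℝ, F) 𝓘(ℝ, F) ∞ c.cod y :=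
  c.contMDiffOn_cod.contMDiffAt (c.cod.open_source.mem_nhds hy)

theorem contMDiffAt_cod_symm {u : F} (hu : u ∈ c.cod.target) :
    ContMDiffAt 𝓘(ℝ, F) 𝓘(ℝ, F) ∞ c.cod.symm u :=
  c.contMDiffOn_cod_symm.contMDiffAt (c.cod.open_target.mem_nhds hu)

theorem contMDiffAt {x : M} (hx : x ∈ c.dom.source) : ContMDiffAt 𝓘(ℝ, E) 𝓘(ℝ, F) ∞ π x := by
  have h1 : π =ᶠ[𝓝 x] c.cod.symm ∘ Prod.fst ∘ c.dom := by
    filter_upwards [c.dom.open_source.mem_nhds hx] with y hy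
    simp only [Function.comp]
    rw [← c.cod_apply y hy, c.cod.left_inv (c.mapsTo y hy)]
  refine ContMDiffAt.congr_of_eventuallyEq ?_ h1
  refine ContMDiffAt.comp x ?_ (contDiff_fst.contMDiff.contMDiffAt.comp x (c.contMDiffAt_dom hx))
  refine c.contMDiffAt_cod_symm ?_
  simp only [Function.comp]
  rw [← c.cod_apply x hx]
  exact c.cod.map_source (c.mapsTo x hx)

/-- The differential of the chart. -/
theorem mfderiv_symm_mfderiv {x : M} (hx : x ∈ c.dom.source) (v : TangentSpace 𝓘(ℝ, E) x) :
    (mfderiv 𝓘(ℝ, F × K) 𝓘(ℝ, E) c.dom.symm (c.dom x) (mfderiv 𝓘(ℝ, E) 𝓘(ℝ, F × K) c.dom x v) : E)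
      = v := by
  have h1 : c.dom.symm ∘ c.dom =ᶠ[𝓝 x] id := by
    filter_upwards [c.dom.open_source.mem_nhds hx] with y hy
    exact c.dom.left_inv hy
  have h2 := mfderiv_comp x ((c.contMDiffAt_dom_symm (c.dom.map_source hx)).mdifferentiableAt
    (by simp)) ((c.contMDiffAt_dom hx).mdifferentiableAt (by simp))
  rw [h1.mfderiv_eq, mfderiv_id] at h2
  exact (DFunLike.congr_fun h2 v).symm

/-- The first component of the differential of the chart is the differential of `π`, read in the
chart of the target. -/
theorem mfderiv_dom_fst {x : M} (hx : x ∈ c.dom.source) (v : TangentSpace 𝓘(ℝ, E) x) :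
    (mfderiv 𝓘(ℝ, E) 𝓘(ℝ, F × K) c.dom x v : F × K).1 =
      mfderiv 𝓘(ℝ, F) 𝓘(ℝ, F) c.cod (π x) (mfderiv 𝓘(ℝ, E) 𝓘(ℝ, F) π x v) := by
  have h1 : c.cod ∘ π =ᶠ[𝓝 x] Prod.fst ∘ c.dom := by
    filter_upwards [c.dom.open_source.mem_nhds hx] with y hy
    exact c.cod_apply y hy
  have h2 := mfderiv_comp x ((c.contMDiffAt_cod (c.mapsTo x hx)).mdifferentiableAt (by simp))
    ((c.contMDiffAt hx).mdifferentiableAt (by simp))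
  have h3 := mfderiv_comp (I' := 𝓘(ℝ, F × K)) (I'' := 𝓘(ℝ, F)) x
    ((contDiff_fst (n := ∞) (𝕜 := ℝ) (E := F) (F := K)).contMDiff.contMDiffAt.mdifferentiableAt
      (x := c.dom x) (by simp)) ((c.contMDiffAt_dom hx).mdifferentiableAt (by simp))
  rw [h1.mfderiv_eq, h3] at h2
  have h4 := DFunLike.congr_fun h2 v
  rw [mfderiv_eq_fderiv, fderiv_fst] at h4
  exact h4

theorem mfderiv_cod_symm_mfderiv {y : N} (hy : y ∈ c.cod.source) (p : TangentSpace 𝓘(ℝ, F) y) :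
    (mfderiv 𝓘(ℝ, F) 𝓘(ℝ, F) c.cod.symm (c.cod y) (mfderiv 𝓘(ℝ, F) 𝓘(ℝ, F) c.cod y p) : F)
      = p := by
  have h1 : c.cod.symm ∘ c.cod =ᶠ[𝓝 y] id := by
    filter_upwards [c.cod.open_source.mem_nhds hy] with z hz
    exact c.cod.left_inv hz
  have h2 := mfderiv_comp y ((c.contMDiffAt_cod_symm (c.cod.map_source hy)).mdifferentiableAt
    (by simp)) ((c.contMDiffAt_cod hy).mdifferentiableAt (by simp))
  rw [h1.mfderiv_eq, mfderiv_id] at h2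
  exact (DFunLike.congr_fun h2 p).symm

/-- In the charts, the differential of `π` is the first projection. -/
theorem mfderiv_mfderiv_symm {x : M} (hx : x ∈ c.dom.source) (w : F × K) :
    (mfderiv 𝓘(ℝ, E) 𝓘(ℝ, F) π x (mfderiv 𝓘(ℝ, F × K) 𝓘(ℝ, E) c.dom.symm (c.dom x) w : E) : F) =
      mfderiv 𝓘(ℝ, F) 𝓘(ℝ, F) c.cod.symm (c.cod (π x)) w.1 := by
  have hw := c.dom.map_source hx
  have h1 : π ∘ c.dom.symm =ᶠ[𝓝 (c.dom x)] c.cod.symm ∘ Prod.fst := by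
    filter_upwards [c.dom.open_target.mem_nhds hw] with w hw
    exact c.apply_symm hw
  have hx' := c.dom.left_inv hx
  have hs : c.dom.symm (c.dom x) ∈ c.dom.source := by rwa [hx']
  have h2 := mfderiv_comp (c.dom x) ((c.contMDiffAt hs).mdifferentiableAt (by simp))
    ((c.contMDiffAt_dom_symm hw).mdifferentiableAt (by simp))
  have hu : (c.dom x).1 ∈ c.cod.target := by
    rw [← c.cod_apply x hx]; exact c.cod.map_source (c.mapsTo x hx)
  have h3 := mfderiv_comp (I' := 𝓘(ℝ, F)) (c.dom x)
    ((c.contMDiffAt_cod_symm hu).mdifferentiableAt (by simp))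
    ((contDiff_fst (n := ∞) (𝕜 := ℝ) (E := F) (F := K)).contMDiff.contMDiffAt.mdifferentiableAt
      (I := 𝓘(ℝ, F × K)) (x := c.dom x) (by simp))
  rw [h1.mfderiv_eq, h3] at h2
  have h4 := DFunLike.congr_fun h2 w
  rw [mfderiv_eq_fderiv, fderiv_fst] at h4
  refine Eq.trans ?_ (h4.symm.trans ?_)
  · exact mfderiv_congr_base π hx'.symm _
  · exact mfderiv_congr_base c.cod.symm (c.cod_apply x hx).symm _

/-- Moving along the first factor lifts a tangent vector of the target. -/
theorem mfderiv_lift {x : M} (hx : x ∈ c.dom.source) (p : F) :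
    (mfderiv 𝓘(ℝ, E) 𝓘(ℝ, F) π x (mfderiv 𝓘(ℝ, F × K) 𝓘(ℝ, E) c.dom.symm (c.dom x)
      ((mfderiv 𝓘(ℝ, F) 𝓘(ℝ, F) c.cod (π x) p : F), (0 : K)) : E) : F) = p :=
  (c.mfderiv_mfderiv_symm hx _).trans (c.mfderiv_cod_symm_mfderiv (c.mapsTo x hx) p)

/-- A submersion has local smooth sections. -/
theorem exists_section {x : M} (hx : x ∈ c.dom.source) : ∃ σ : N → M, σ (π x) = x ∧
    ∀ᶠ y in 𝓝 (π x), ContMDiffAt 𝓘(ℝ, F) 𝓘(ℝ, E) ∞ σ y ∧ π (σ y) = y := by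
  have hc : ContinuousAt (fun y => (c.cod y, (c.dom x).2)) (π x) :=
    (c.cod.continuousAt (c.mapsTo x hx)).prodMk continuousAt_const
  have h0 : (c.cod (π x), (c.dom x).2) = c.dom x := by rw [c.cod_apply x hx]
  have ht : c.dom.target ∈ 𝓝 (c.cod (π x), (c.dom x).2) := by
    rw [h0]; exact c.dom.open_target.mem_nhds (c.dom.map_source hx)
  -- The section keeps the K-coordinate frozen at its value at `x`.
  refine ⟨fun y => c.dom.symm (c.cod y, (c.dom x).2), by simp only [h0, c.dom.left_inv hx], ?_⟩
  filter_upwards [hc.eventually_mem ht, c.cod.open_source.mem_nhds (c.mapsTo x hx)] with y hy hy'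
  refine ⟨ContMDiffAt.comp y (I' := 𝓘(ℝ, F × K)) (c.contMDiffAt_dom_symm hy) ?_, ?_⟩
  · exact (c.contMDiffAt_cod hy').prodMk_space contMDiffAt_const
  · rw [c.apply_symm hy, c.cod.left_inv hy']

end SubmersionChart
end Submersion

/-! ### Functions along integral curves, and the size of an integral curve -/

section Fibres

variable {E : Type*} [NormedAddCommGroup E] [NormedSpace ℝ E] [CompleteSpace E]
  {M : Type*} [TopologicalSpace M] [T2Space M] [ChartedSpace E M] [IsManifold 𝓘(ℝ, E) ∞ M]
  {F : Type*} [NormedAddCommGroup F] [NormedSpace ℝ F]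
  {N : Type*} [TopologicalSpace N] [ChartedSpace F N]
  {R : VectorFields E M}

omit [T2Space M] in
theorem exists_integralCurve (R : VectorFields E M) (x : M) : ∃ (γ : ℝ → M) (ε : ℝ), 0 < ε ∧
    γ 0 = x ∧ IsMIntegralCurveOn (I := 𝓘(ℝ, E)) γ (fun z => R z) (Set.Ioo (-ε) ε) := by
  have h1 : (1 : WithTop ℕ∞) ≤ ∞ := by exact_mod_cast le_top
  have : IsManifold 𝓘(ℝ, E) 1 M := IsManifold.of_le (n := ∞) h1
  obtain ⟨γ, hx, hγ⟩ := exists_isMIntegralCurveAt_of_contMDiffAt_boundaryless 0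
    ((R.contMDiff x).of_le h1)
  obtain ⟨ε, hε, h⟩ := isMIntegralCurveAt_iff'.mp hγ
  rw [Real.ball_eq_Ioo, zero_sub, zero_add] at h
  exact ⟨γ, ε, hε, hx, h⟩

omit [CompleteSpace E] [T2Space M] in
theorem integralCurve_hasMFDerivAt {γ : ℝ → M} {a b t : ℝ}
    (hγ : IsMIntegralCurveOn (I := 𝓘(ℝ, E)) γ (fun z => R z) (Set.Ioo a b))
    (ht : t ∈ Set.Ioo a b) :
    HasMFDerivAt 𝓘(ℝ, ℝ) 𝓘(ℝ, E) γ t ((1 : ℝ →L[ℝ] ℝ).smulRight (R (γ t))) :=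
  (hγ t ht).hasMFDerivAt (isOpen_Ioo.mem_nhds ht)

omit [CompleteSpace E] [T2Space M] in
/-- The derivative of a function along an integral curve. -/
theorem integralCurve_hasDerivAt {K : Type*} [NormedAddCommGroup K] [NormedSpace ℝ K]
    {f : M → K} {γ : ℝ → M} {a b t : ℝ}
    (hγ : IsMIntegralCurveOn (I := 𝓘(ℝ, E)) γ (fun z => R z) (Set.Ioo a b))
    (ht : t ∈ Set.Ioo a b) (hf : MDifferentiableAt 𝓘(ℝ, E) 𝓘(ℝ, K) f (γ t)) :
    HasDerivAt (f ∘ γ) (mfderiv 𝓘(ℝ, E) 𝓘(ℝ, K) f (γ t) (R (γ t)) : K) t := by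
  let A : E →L[ℝ] K := mfderiv 𝓘(ℝ, E) 𝓘(ℝ, K) f (γ t)
  let v : E := R (γ t)
  have h : HasFDerivAt (f ∘ γ) (A.comp ((1 : ℝ →L[ℝ] ℝ).smulRight v)) t :=
    (hf.hasMFDerivAt.comp t (integralCurve_hasMFDerivAt hγ ht)).hasFDerivAt
  have h2 : HasDerivAt (f ∘ γ) (A v) t := by simpa using h.hasDerivAt
  exact h2

omit [CompleteSpace E] [T2Space M] in
/-- A function that is locally constant along the integral curves is constant along them. -/
theorem SameIntegralCurve.eq_of_locally_eq {A : Type*} {f : M → A}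
    (hf : ∀ x, ∀ᶠ x' in 𝓝 x, SameIntegralCurve R x x' → f x' = f x) {x y : M}
    (h : SameIntegralCurve R x y) : f x = f y := by
  obtain ⟨γ, a, b, s, t, hγ, hs, ht, rfl, rfl⟩ := h
  -- For the discrete topology on `A`, local constancy is continuity, and an interval is connected.
  let : TopologicalSpace A := ⊥
  have : DiscreteTopology A := ⟨rfl⟩
  refine isPreconnected_Ioo.constant (f := f ∘ γ) (fun r hr => ?_) hs ht
  refine ContinuousAt.continuousWithinAt ?_
  have h1 := (integralCurve_hasMFDerivAt hγ hr).continuousAt.eventually (hf (γ r))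
  refine (continuousAt_const (y := f (γ r))).congr ?_
  filter_upwards [h1, isOpen_Ioo.mem_nhds hr] with r' hr' hm
  exact (hr' ⟨γ, a, b, r, r', hγ, hr, hm, rfl, rfl⟩).symm

omit [CompleteSpace E] [T2Space M] in
/-- A function whose derivative along the vector field vanishes is constant along the integral
curves. -/
theorem SameIntegralCurve.eq_of_mfderiv_eq_zero {f : M → ℝ}
    (hf : MDifferentiable 𝓘(ℝ, E) 𝓘(ℝ, ℝ) f)
    (h0 : ∀ x, dfun f x (R x) = 0) {x y : M} (h : SameIntegralCurve R x y) : f x = f y := by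
  obtain ⟨γ, a, b, s, t, hγ, hs, ht, rfl, rfl⟩ := h
  have hd : ∀ r ∈ Set.Ioo a b, HasDerivAt (f ∘ γ) 0 r := fun r hr => by
    have := integralCurve_hasDerivAt hγ hr (hf (γ r))
    rwa [show (mfderiv 𝓘(ℝ, E) 𝓘(ℝ, ℝ) f (γ r) (R (γ r)) : ℝ) = 0 from h0 _] at this
  exact (convex_Ioo a b).is_const_of_fderivWithin_eq_zero (𝕜 := ℝ) (f := f ∘ γ)
    (fun r hr => (hd r hr).differentiableAt.differentiableWithinAt)
    (fun r hr => by
      rw [fderivWithin_of_isOpen isOpen_Ioo hr]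
      ext
      simp [(hd r hr).deriv]) hs ht

omit [CompleteSpace E] in
/-- An integral curve is covered by countably many integral curves on intervals. -/
theorem exists_countable_cover (R : VectorFields E M) (x : M) :
    ∃ γ : ℚ × ℚ → ℝ → M, ∀ y, SameIntegralCurve R x y → ∃ p : ℚ × ℚ,
      IsMIntegralCurveOn (I := 𝓘(ℝ, E)) (γ p) (fun z => R z) (Set.Ioo (p.1 : ℝ) p.2) ∧
      y ∈ γ p '' Set.Ioo (p.1 : ℝ) p.2 := by
  have h1 : (1 : WithTop ℕ∞) ≤ ∞ := by exact_mod_cast le_top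
  have : IsManifold 𝓘(ℝ, E) 1 M := IsManifold.of_le (n := ∞) h1
  -- For each rational interval around 0 fix one integral curve starting at `x`. Uniqueness of
  -- integral curves makes it agree with any other such curve, so countably many suffice.
  have key : ∀ p : ℚ × ℚ, ∃ γ : ℝ → M, (0 : ℝ) ∈ Set.Ioo (p.1 : ℝ) p.2 →
      ∀ γ' : ℝ → M, γ' 0 = x →
        IsMIntegralCurveOn (I := 𝓘(ℝ, E)) γ' (fun z => R z) (Set.Ioo (p.1 : ℝ) p.2) →
        IsMIntegralCurveOn (I := 𝓘(ℝ, E)) γ (fun z => R z) (Set.Ioo (p.1 : ℝ) p.2) ∧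
        Set.EqOn γ γ' (Set.Ioo (p.1 : ℝ) p.2) := by
    intro p
    by_cases hp : ∃ γ : ℝ → M, γ 0 = x ∧
        IsMIntegralCurveOn (I := 𝓘(ℝ, E)) γ (fun z => R z) (Set.Ioo (p.1 : ℝ) p.2)
    · obtain ⟨γ, h0, hγ⟩ := hp
      exact ⟨γ, fun hm γ' h0' hγ' => ⟨hγ,
        isMIntegralCurveOn_Ioo_eqOn_of_contMDiff_boundaryless hm (R.contMDiff.of_le h1) hγ hγ'
          (h0.trans h0'.symm)⟩⟩
    -- A junk value, for intervals carrying no integral curve through `x`; such a `γ p` need not be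
    -- an integral curve.
    · exact ⟨fun _ => x, fun _ γ' h0' hγ' => (hp ⟨γ', h0', hγ'⟩).elim⟩
  choose γ hγ using key
  refine ⟨γ, fun y hy => ?_⟩
  obtain ⟨δ, a, b, s, t, hδ, hs, ht, hx, rfl⟩ := hy
  have hδ' := hδ.comp_add s
  -- After the translation `x` sits at time 0 and `y` at time `t - s`; the rational interval must
  -- contain both.
  obtain ⟨p, hp1, hp2⟩ := exists_rat_btwn (show a - s < min 0 (t - s) by
    rw [lt_min_iff]; constructor <;> linarith [hs.1, ht.1])
  obtain ⟨q, hq1, hq2⟩ := exists_rat_btwn (show max 0 (t - s) < b - s by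
    rw [max_lt_iff]; constructor <;> linarith [hs.2, ht.2])
  rw [lt_min_iff] at hp2
  rw [max_lt_iff] at hq1
  have hsub : Set.Ioo (p : ℝ) q ⊆ {r | r + s ∈ Set.Ioo a b} := by
    rintro r ⟨h3, h4⟩
    constructor <;> linarith
  obtain ⟨h5, h6⟩ := hγ (p, q) ⟨hp2.1, hq1.1⟩ _ (by simp [hx]) (hδ'.mono hsub)
  refine ⟨(p, q), h5, t - s, ⟨hp2.2, hq1.2⟩, ?_⟩
  rw [h6 ⟨hp2.2, hq1.2⟩]
  simp

omit [CompleteSpace E] [T2Space M] in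
-- This is the fibre component of the tangent map of `f` composed with the section R. It bounds the
-- speed of `f ∘ γ` locally.
theorem continuousOn_mfderiv_vectorField {K : Type*} [NormedAddCommGroup K] [NormedSpace ℝ K]
    {f : M → K} {U : Set M} (hU : IsOpen U) (hf : ContMDiffOn 𝓘(ℝ, E) 𝓘(ℝ, K) ∞ f U) :
    ContinuousOn (fun x => (mfderiv 𝓘(ℝ, E) 𝓘(ℝ, K) f x (R x) : K)) U := by
  have h1 := hf.contMDiffOn_tangentMapWithin (m := ∞) le_rfl hU.uniqueMDiffOn
  have h2 := h1.continuousOn.comp (R.contMDiff.continuous.continuousOn (s := U)) fun x hx => hx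
  have h3 := (contMDiff_snd_tangentBundle_modelSpace K 𝓘(ℝ, K) (n := ∞)).continuous.comp_continuousOn h2
  refine h3.congr fun x hx => ?_
  change (mfderiv 𝓘(ℝ, E) 𝓘(ℝ, K) f x (R x) : K) = mfderivWithin 𝓘(ℝ, E) 𝓘(ℝ, K) f U x (R x)
  rw [mfderivWithin_of_isOpen hU hx]

omit [CompleteSpace E] [T2Space M] in
/-- The image of an integral curve under a smooth map has Hausdorff dimension at most one. -/
theorem dimH_image_integralCurve_le {K : Type*} [NormedAddCommGroup K] [NormedSpace ℝ K]
    {f : M → K} {U : Set M} (hU : IsOpen U) (hf : ContMDiffOn 𝓘(ℝ, E) 𝓘(ℝ, K) ∞ f U)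
    {γ : ℝ → M} {a b : ℝ}
    (hγ : IsMIntegralCurveOn (I := 𝓘(ℝ, E)) γ (fun z => R z) (Set.Ioo a b)) :
    dimH (f '' (γ '' Set.Ioo a b ∩ U)) ≤ 1 := by
  have hset : f '' (γ '' Set.Ioo a b ∩ U) = (f ∘ γ) '' (Set.Ioo a b ∩ γ ⁻¹' U) := by
    rw [Set.image_comp, Set.image_inter_preimage]
  -- `f ∘ γ` has a continuous derivative, so it is locally Lipschitz and cannot raise the dimension
  -- of a subset of the line.
  rw [hset, ← Real.dimH_univ]
  refine le_trans (dimH_image_le_of_locally_lipschitzOn fun t ht => ?_) (dimH_mono (Set.subset_univ _))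
  have hopen : IsOpen (Set.Ioo a b ∩ γ ⁻¹' U) :=
    hγ.continuousOn.isOpen_inter_preimage isOpen_Ioo hU
  have hder : ∀ r ∈ Set.Ioo a b ∩ γ ⁻¹' U,
      HasDerivAt (f ∘ γ) (mfderiv 𝓘(ℝ, E) 𝓘(ℝ, K) f (γ r) (R (γ r)) : K) r := fun r hr =>
    integralCurve_hasDerivAt hγ hr.1
      ((hf.contMDiffAt (hU.mem_nhds hr.2)).mdifferentiableAt (by simp))
  have hcont : ContinuousAt (fun r => (mfderiv 𝓘(ℝ, E) 𝓘(ℝ, K) f (γ r) (R (γ r)) : K)) t :=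
    ((continuousOn_mfderiv_vectorField hU hf).comp (hγ.continuousOn.mono Set.inter_subset_left)
      (fun r hr => hr.2)).continuousAt (hopen.mem_nhds ht)
  have hbd := hcont.nnnorm.eventually_lt_const (lt_add_one _)
  obtain ⟨ε, hε, hball⟩ := Metric.eventually_nhds_iff_ball.1
    (hbd.and (hopen.eventually_mem ht))
  refine ⟨_, Metric.ball t ε, mem_nhdsWithin_of_mem_nhds (Metric.ball_mem_nhds t hε),
    (convex_ball t ε).lipschitzOnWith_of_nnnorm_hasDerivWithin_le
      (fun r hr => (hder r (hball r hr).2).hasDerivWithinAt) fun r hr => (hball r hr).1.le⟩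

end Fibres

/-! ### The kernel of Tπ -/

section Quotient

variable {E : Type*} [NormedAddCommGroup E] [NormedSpace ℝ E] [CompleteSpace E]
  {M : Type*} [TopologicalSpace M] [T2Space M] [ChartedSpace E M] [IsManifold 𝓘(ℝ, E) ∞ M]
  {F : Type*} [NormedAddCommGroup F] [NormedSpace ℝ F]
  {N : Type*} [TopologicalSpace N] [ChartedSpace F N]
  {K : Type*} [NormedAddCommGroup K] [NormedSpace ℝ K]
  {R : VectorFields E M} {π : M → N}

omit [CompleteSpace E] in
/-- If the fibres of a submersion are integral curves, then they have dimension at most one. -/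
theorem SubmersionChart.finrank_le_one [FiniteDimensional ℝ K]
    (hfib : ∀ x y, π x = π y → SameIntegralCurve R x y)
    (c : SubmersionChart (E := E) (F := F) K π) {x : M} (hx : x ∈ c.dom.source) :
    Module.finrank ℝ K ≤ 1 := by
  -- An open piece of K whose points, lifted by the chart at fixed F-coordinate, all lie in the
  -- fibre of `x`. Its Hausdorff dimension is that of K.
  let V : Set K := {k | ((c.dom x).1, k) ∈ c.dom.target}
  have hV : V ∈ 𝓝 (c.dom x).2 :=
    (c.dom.open_target.preimage (by fun_prop : Continuous fun k : K => ((c.dom x).1, k))).mem_nhds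
      (c.dom.map_source hx)
  obtain ⟨γ, hγ⟩ := exists_countable_cover R x
  -- Requiring `γ p` to be an integral curve makes `S p` empty for the junk curves of the cover.
  let S : ℚ × ℚ → Set K := fun p => {k | IsMIntegralCurveOn (I := 𝓘(ℝ, E)) (γ p) (fun z => R z)
    (Set.Ioo (p.1 : ℝ) p.2) ∧
      k ∈ (fun y => (c.dom y).2) '' (γ p '' Set.Ioo (p.1 : ℝ) p.2 ∩ c.dom.source)}
  have hVS : V ⊆ ⋃ p, S p := by
    intro k hk
    have hs := c.dom.map_target hk
    have h1 : π x = π (c.dom.symm ((c.dom x).1, k)) := by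
      rw [c.apply_eq_iff hx hs, c.dom.right_inv hk]
    obtain ⟨p, hp, hp'⟩ := hγ _ (hfib _ _ h1)
    exact Set.mem_iUnion.2 ⟨p, hp, _, ⟨hp', hs⟩, by
      change (c.dom _).2 = k; rw [c.dom.right_inv hk]⟩
  have hsnd : ContMDiffOn 𝓘(ℝ, E) 𝓘(ℝ, K) ∞ (fun y => (c.dom y).2) c.dom.source :=
    (contDiff_snd (n := ∞) (𝕜 := ℝ) (E := F) (F := K)).contMDiff.comp_contMDiffOn c.contMDiffOn_dom
  have hS : ∀ p, dimH (S p) ≤ 1 := by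
    intro p
    by_cases hp : IsMIntegralCurveOn (I := 𝓘(ℝ, E)) (γ p) (fun z => R z) (Set.Ioo (p.1 : ℝ) p.2)
    · exact (dimH_mono fun k hk => hk.2).trans
        (dimH_image_integralCurve_le c.dom.open_source hsnd hp)
    · have : S p = ∅ := Set.eq_empty_of_forall_notMem fun k hk => hp hk.1
      simp [this]
  have h2 : (Module.finrank ℝ K : ENNReal) ≤ 1 := by
    rw [← Real.dimH_of_mem_nhds hV]
    refine (dimH_mono hVS).trans ?_
    rw [dimH_iUnion]
    exact iSup_le hS
  exact_mod_cast h2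

omit [T2Space M] in
-- π is constant along the integral curve through `x`, whose velocity is R; apply the chain rule at
-- time 0.
theorem mfderiv_projection_apply_self (hfib : ∀ x y, SameIntegralCurve R x y → π x = π y) {x : M}
    (hπ : MDifferentiableAt 𝓘(ℝ, E) 𝓘(ℝ, F) π x) :
    (mfderiv 𝓘(ℝ, E) 𝓘(ℝ, F) π x (R x) : F) = 0 := by
  obtain ⟨γ, ε, hε, h0, hγ⟩ := exists_integralCurve R x
  have hm : (0 : ℝ) ∈ Set.Ioo (-ε) ε := ⟨by linarith, hε⟩
  subst h0
  have h1 := hπ.hasMFDerivAt.comp 0 (integralCurve_hasMFDerivAt hγ hm)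
  have h2 : π ∘ γ =ᶠ[𝓝 0] fun _ => π (γ 0) := by
    filter_upwards [isOpen_Ioo.mem_nhds hm] with t ht
    exact hfib _ _ ⟨γ, _, _, t, 0, hγ, ht, hm, rfl, rfl⟩
  have h3 := h1.mfderiv
  rw [h2.mfderiv_eq, mfderiv_const] at h3
  let A : E →L[ℝ] F := mfderiv 𝓘(ℝ, E) 𝓘(ℝ, F) π (γ 0)
  let v : E := R (γ 0)
  have h4 : (0 : ℝ →L[ℝ] F) = A.comp ((1 : ℝ →L[ℝ] ℝ).smulRight v) := h3
  have h5 := DFunLike.congr_fun h4 1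
  have h6 : A v = 0 := by simpa using h5.symm
  exact h6

/-- The kernel of the differential of the projection to the space of integral curves. -/
theorem SubmersionChart.exists_eq_smul_of_mfderiv_eq_zero [FiniteDimensional ℝ K]
    (hfib : ∀ x y, π x = π y ↔ SameIntegralCurve R x y)
    (c : SubmersionChart (E := E) (F := F) K π) {x : M} (hx : x ∈ c.dom.source) (hR : R x ≠ 0)
    {v : TangentSpace 𝓘(ℝ, E) x} (hv : (mfderiv 𝓘(ℝ, E) 𝓘(ℝ, F) π x v : F) = 0) :
    ∃ a : ℝ, v = a • R x := by
  let T : E →L[ℝ] F × K := mfderiv 𝓘(ℝ, E) 𝓘(ℝ, F × K) c.dom x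
  let T' : F × K →L[ℝ] E := mfderiv 𝓘(ℝ, F × K) 𝓘(ℝ, E) c.dom.symm (c.dom x)
  have hT : ∀ u, T' (T u) = u := c.mfderiv_symm_mfderiv hx
  have hfst : ∀ u : E, (mfderiv 𝓘(ℝ, E) 𝓘(ℝ, F) π x u : F) = 0 → (T u).1 = 0 := by
    intro u hu
    refine (c.mfderiv_dom_fst hx u).trans ?_
    exact (congrArg (mfderiv 𝓘(ℝ, F) 𝓘(ℝ, F) c.cod (π x)) hu).trans (map_zero _)
  have h1 := hfst v hv
  have h2 := hfst (R x) (mfderiv_projection_apply_self (fun x y => (hfib x y).2)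
    ((c.contMDiffAt hx).mdifferentiableAt (by simp)))
  -- The chart derivative `T` is injective and `T (R x)` has no F-component, so its K-component
  -- spans K.
  have h3 : (T (R x)).2 ≠ 0 := by
    intro h0
    refine hR ?_
    have h4 : T (R x) = 0 := Prod.ext h2 h0
    have h5 := hT (R x)
    rw [h4, map_zero] at h5
    exact h5.symm
  obtain ⟨w, hw⟩ := finrank_le_one_iff.1 (c.finrank_le_one (fun x y => (hfib x y).1) hx)
  obtain ⟨a, ha⟩ := hw (T v).2
  obtain ⟨b, hb⟩ := hw (T (R x)).2
  have hb0 : b ≠ 0 := by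
    rintro rfl
    exact h3 (by rw [← hb, zero_smul])
  refine ⟨a / b, ?_⟩
  have h4 : T v = (a / b) • T (R x) := by
    refine Prod.ext ?_ ?_
    · rw [Prod.smul_fst, h1, h2, smul_zero]
    · rw [Prod.smul_snd, ← ha, ← hb, smul_smul, div_mul_cancel₀ _ hb0]
  have h5 := hT v
  rw [h4, map_smul] at h5
  exact h5.symm.trans (congrArg (fun u : E => (a / b) • u) (hT (R x)))

end Quotient

/-! ### Descent of dη along the fibres -/

/-- A closed two-form with `κ` in its kernel is constant in the direction `κ`. -/
theorem fderiv_apply_eq_zero_of_kernel {V : Type*} [NormedAddCommGroup V] [NormedSpace ℝ V]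
    {β : V → V [⋀^Fin 2]→L[ℝ] ℝ} {w κ : V} (hβ : DifferentiableAt ℝ β w) (hd : extDeriv β w = 0)
    (hκ : ∀ᶠ w' in 𝓝 w, ∀ q, β w' ![κ, q] = 0) (a b : V) :
    fderiv ℝ (fun w' => β w' ![a, b]) w κ = 0 := by
  -- For constant fields, dβ(κ,a,b) = ∂_κ β(a,b) - ∂_a β(κ,b) + ∂_b β(κ,a), and the last two terms
  -- differentiate functions that vanish near `w`.
  have h := extDeriv_apply hβ ![κ, a, b]
  have h0 : ∀ q, fderiv ℝ (fun w' => β w' ![κ, q]) w = 0 := by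
    intro q
    have : (fun w' => β w' ![κ, q]) =ᶠ[𝓝 w] fun _ => 0 := hκ.mono fun w' hw' => hw' q
    rw [this.fderiv_eq, fderiv_fun_const]; rfl
  have e0 : (0 : Fin 3).removeNth ![κ, a, b] = ![a, b] := by
    ext i; fin_cases i <;> rfl
  have e1 : (1 : Fin 3).removeNth ![κ, a, b] = ![κ, b] := by
    ext i; fin_cases i <;> rfl
  have e2 : (2 : Fin 3).removeNth ![κ, a, b] = ![κ, a] := by
    ext i; fin_cases i <;> rfl
  rw [hd, Fin.sum_univ_three, e0, e1, e2, h0, h0] at h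
  simpa using h.symm

section Reduction

variable {E : Type*} [NormedAddCommGroup E] [NormedSpace ℝ E]
  {M : Type*} [TopologicalSpace M] [ChartedSpace E M] [IsManifold 𝓘(ℝ, E) ∞ M]
  {F : Type*} [NormedAddCommGroup F] [NormedSpace ℝ F]
  {N : Type*} [TopologicalSpace N] [ChartedSpace F N]
  {K : Type*} [NormedAddCommGroup K] [NormedSpace ℝ K] {π : M → N}

/-- If `dη` descends pointwise to a two-form on the tangent spaces of the target of a submersion,
then the descended form is locally constant along the fibres. -/
theorem SubmersionChart.eventually_eq_of_descends (c : SubmersionChart (E := E) (F := F) K π)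
    {η : Form E M 1} (hη : IsSmoothForm η) {B : M → F [⋀^Fin 2]→L[ℝ] ℝ}
    (hB : ∀ x v w, B x ![mfderiv 𝓘(ℝ, E) 𝓘(ℝ, F) π x v, mfderiv 𝓘(ℝ, E) 𝓘(ℝ, F) π x w] =
      η.d x ![v, w]) {x : M} (hx : x ∈ c.dom.source) :
    ∀ᶠ x' in 𝓝 x, π x = π x' → B x' = B x := by
  let β : F × K → (F × K) [⋀^Fin 2]→L[ℝ] ℝ := Form.pullback c.dom.symm η.d
  have hβB : ∀ z ∈ c.dom.source, ∀ p q : F × K, β (c.dom z) ![p, q] =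
      B z ![mfderiv 𝓘(ℝ, F) 𝓘(ℝ, F) c.cod.symm (c.cod (π z)) p.1,
        mfderiv 𝓘(ℝ, F) 𝓘(ℝ, F) c.cod.symm (c.cod (π z)) q.1] := by
    intro z hz p q
    have h1 := hB z (mfderiv 𝓘(ℝ, F × K) 𝓘(ℝ, E) c.dom.symm (c.dom z) p : E)
      (mfderiv 𝓘(ℝ, F × K) 𝓘(ℝ, E) c.dom.symm (c.dom z) q : E)
    have e1 := c.mfderiv_mfderiv_symm hz p
    have e2 := c.mfderiv_mfderiv_symm hz q
    refine Eq.trans ?_ (h1.symm.trans ?_)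
    · refine Eq.trans ?_ (Form.apply_congr η.d (c.dom.left_inv hz) _)
      refine congrArg (η.d (c.dom.symm (c.dom z)) : E [⋀^Fin 2]→L[ℝ] ℝ) ?_
      funext i
      fin_cases i <;> rfl
    · exact congrArg₂ (fun a b : F => B z ![a, b]) e1 e2
  -- Being d of the pulled-back one-form, β inherits both smoothness and closedness.
  have hβd : ∀ w ∈ c.dom.target, β =ᶠ[𝓝 w]
      extDeriv (E := F × K) (F := ℝ) (Form.pullback c.dom.symm η) := by
    intro w hw
    filter_upwards [c.dom.open_target.mem_nhds hw] with w' hw'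
    exact (hη.extDeriv_pullback (c.contMDiffAt_dom_symm hw')).symm
  have hsm : ∀ w ∈ c.dom.target, ContDiffAt ℝ ∞ β w := fun w hw =>
    (contDiffAt_extDeriv (hη.contDiffAt_pullback
      (c.contMDiffAt_dom_symm hw))).congr_of_eventuallyEq (hβd w hw)
  have hcl : ∀ w ∈ c.dom.target, extDeriv β w = 0 := by
    intro w hw
    rw [(hβd w hw).extDeriv_eq]
    refine extDeriv_extDeriv_apply (r := ∞) (hη.contDiffAt_pullback (c.contMDiffAt_dom_symm hw)) ?_
    rw [minSmoothness_of_isRCLikeNormedField]; exact WithTop.coe_le_coe.2 le_top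
  have hker : ∀ w ∈ c.dom.target, ∀ (κ : K) q, β w ![(0, κ), q] = 0 := by
    intro w hw κ q
    have h := hβB _ (c.dom.map_target hw) (0, κ) q
    rw [c.dom.right_inv hw] at h
    rw [h]
    refine form_two_apply_eq_zero (α := B _) (v := 0) ?_ _ 0 ?_
    · intro u
      exact (B (c.dom.symm w)).map_coord_zero (m := ![0, u]) 0 rfl
    · exact map_zero _
  -- A sup-norm ball in F × K inside the chart: its slice at fixed F-coordinate is a ball in K,
  -- hence convex, so a vanishing derivative there gives a constant.
  obtain ⟨ε, hε, hball⟩ := Metric.mem_nhds_iff.1 (c.dom.open_target.mem_nhds (c.dom.map_source hx))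
  filter_upwards [c.dom.open_source.mem_nhds hx,
    (c.contMDiffAt_dom hx).continuousAt.eventually_mem (Metric.ball_mem_nhds _ hε)]
    with x' hx' hxb hπ
  have hfst := (c.apply_eq_iff hx hx').1 hπ
  let U : Set K := Metric.ball (c.dom x).2 ε
  have hU : ∀ k ∈ U, ((c.dom x).1, k) ∈ c.dom.target := by
    intro k hk
    refine hball ?_
    rw [Metric.mem_ball, Prod.dist_eq]
    simpa [hε, U] using hk
  have hconst : ∀ a b : F × K, β ((c.dom x).1, (c.dom x').2) ![a, b] =
      β ((c.dom x).1, (c.dom x).2) ![a, b] := by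
    intro a b
    have hd : ∀ k ∈ U, HasFDerivAt (fun k : K => β ((c.dom x).1, k) ![a, b]) (0 : K →L[ℝ] ℝ) k := by
      intro k hk
      have hw := hU k hk
      have h1 : DifferentiableAt ℝ (fun w => β w ![a, b]) ((c.dom x).1, k) := by
        have := (hsm _ hw).differentiableAt (by simp)
        fun_prop
      have h2 := h1.hasFDerivAt.comp k (hasFDerivAt_prodMk_right (c.dom x).1 k)
      convert! h2 using 1
      ext κ
      have h3 := fderiv_apply_eq_zero_of_kernel ((hsm _ hw).differentiableAt (by simp)) (hcl _ hw)
        (κ := (0, κ)) (by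
          filter_upwards [c.dom.open_target.mem_nhds hw] with w' hw' q
          exact hker w' hw' κ q) a b
      simpa using h3.symm
    refine (convex_ball (c.dom x).2 ε).is_const_of_fderivWithin_eq_zero (𝕜 := ℝ)
      (f := fun k : K => β ((c.dom x).1, k) ![a, b])
      (fun k hk => (hd k hk).differentiableAt.differentiableWithinAt) (fun k hk => ?_) ?_
      (Metric.mem_ball_self hε)
    · rw [fderivWithin_of_isOpen Metric.isOpen_ball hk, (hd k hk).fderiv]
    · rw [Metric.mem_ball, Prod.dist_eq] at hxb
      exact (le_max_right _ _).trans_lt hxb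
  ext u
  have hu : u = ![u 0, u 1] := by ext i; fin_cases i <;> rfl
  have hlift : ∀ p : F, (mfderiv 𝓘(ℝ, F) 𝓘(ℝ, F) c.cod.symm (c.cod (π x))
      (mfderiv 𝓘(ℝ, F) 𝓘(ℝ, F) c.cod (π x) p) : F) = p :=
    c.mfderiv_cod_symm_mfderiv (c.mapsTo x hx)
  -- `L` depends on the base point only through π, so the same lifted vectors compute both `B x` and
  -- `B x'`.
  let L : F → F × K := fun p => ((mfderiv 𝓘(ℝ, F) 𝓘(ℝ, F) c.cod (π x) p : F), 0)
  have hval : ∀ z ∈ c.dom.source, π x = π z → ∀ p q : F, β (c.dom z) ![L p, L q] = B z ![p, q] := by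
    intro z hz hπz p q
    rw [hβB z hz, ← hπz]
    exact congrArg₂ (fun a b : F => B z ![a, b]) (hlift p) (hlift q)
  rw [hu, ← hval x' hx' hπ, ← hval x hx rfl]
  have h4 : c.dom x' = ((c.dom x).1, (c.dom x').2) := by rw [hfst]
  rw [h4]
  exact hconst _ _

end Reduction

theorem eventually_contMDiffAt_extChartAt_symm {F : Type*} [NormedAddCommGroup F] [NormedSpace ℝ F]
    {N : Type*} [TopologicalSpace N] [ChartedSpace F N] [IsManifold 𝓘(ℝ, F) ∞ N] {y : N} {z : F}
    (hz : z ∈ (extChartAt 𝓘(ℝ, F) y).target) :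
    ∀ᶠ z' in 𝓝 z, ContMDiffAt 𝓘(ℝ, F) 𝓘(ℝ, F) ∞ (extChartAt 𝓘(ℝ, F) y).symm z' := by
  have ho := isOpen_extChartAt_target (I := 𝓘(ℝ, F)) y
  filter_upwards [ho.mem_nhds hz] with z' hz'
  exact (contMDiffOn_extChartAt_symm y).contMDiffAt (ho.mem_nhds hz')

/-! ### Reduction by the Reeb field: existence of Ω -/

section ReebReduction

variable {E : Type*} [NormedAddCommGroup E] [NormedSpace ℝ E]
  {M : Type*} [TopologicalSpace M] [ChartedSpace E M] [IsManifold 𝓘(ℝ, E) ∞ M]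
  {F : Type*} [NormedAddCommGroup F] [NormedSpace ℝ F]
  {N : Type*} [TopologicalSpace N] [ChartedSpace F N]

/-- `π` is a surjective submersion whose fibres are the integral curves of the Reeb vector field
`R` of the contact form `η`. -/
structure IsReebReduction (n : ℕ) (K : Type*) [NormedAddCommGroup K] [NormedSpace ℝ K]
    (η : Form E M 1) (R : VectorFields E M) (π : M → N) : Prop where
  contact : IsContactForm n η
  reeb : IsReebField η R
  submersion : Manifold.IsSubmersionOfComplement K 𝓘(ℝ, E) 𝓘(ℝ, F) ∞ π
  surjective : Function.Surjective π
  fibre : ∀ x y, π x = π y ↔ SameIntegralCurve R x y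

variable {K : Type*} [NormedAddCommGroup K] [NormedSpace ℝ K]
  {n : ℕ} {η : Form E M 1} {R : VectorFields E M} {π : M → N}

/-- Adding multiples of `R` to the arguments does not change `dη`. -/
theorem IsReebField.d_add_smul (hR : IsReebField η R) (x : M) (v w : TangentSpace 𝓘(ℝ, E) x)
    (a b : ℝ) : η.d x ![v + a • R x, w + b • R x] = η.d x ![v, w] := by
  have h1 : ∀ (v w : TangentSpace 𝓘(ℝ, E) x) (a : ℝ),
      η.d x ![v + a • R x, w] = η.d x ![v, w] := by
    intro v w a
    have h3 := (η.d x).map_update_add ![v, w] 0 v (a • R x)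
    have h4 := (η.d x).map_update_smul ![v, w] 0 a (R x)
    simp only [Matrix.vecCons, Fin.update_cons_zero] at h3 h4 ⊢
    have h5 := hR.contract_d x w
    simp only [Matrix.vecCons] at h5
    rw [h3, h4, h5, smul_zero, add_zero]
  have hs : ∀ v w : TangentSpace 𝓘(ℝ, E) x, η.d x ![v, w] = - η.d x ![w, v] := fun v w =>
    form_two_swap (V := E) (η.d x) v w
  rw [h1, hs, h1, ← hs]

namespace IsReebReduction

variable (h : IsReebReduction (F := F) n K η R π)
include h

theorem contMDiff : ContMDiff 𝓘(ℝ, E) 𝓘(ℝ, F) ∞ π := h.submersion.contMDiff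

theorem mdifferentiable : MDifferentiable 𝓘(ℝ, E) 𝓘(ℝ, F) π := h.contMDiff.mdifferentiable (by simp)

theorem exists_chart (x : M) : ∃ c : SubmersionChart (E := E) (F := F) K π, x ∈ c.dom.source :=
  exists_submersionChart h.submersion x

theorem exists_section (x : M) : ∃ σ : N → M, σ (π x) = x ∧
    ∀ᶠ y in 𝓝 (π x), ContMDiffAt 𝓘(ℝ, F) 𝓘(ℝ, E) ∞ σ y ∧ π (σ y) = y :=
  let ⟨c, hc⟩ := h.exists_chart x
  c.exists_section hc

/-- Choosing lifts linearly and continuously allows dη to be pulled back to an alternating form on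
F. -/
theorem exists_rightInverse (x : M) : ∃ s : F →L[ℝ] E, ∀ p : F,
    (mfderiv 𝓘(ℝ, E) 𝓘(ℝ, F) π x (s p) : F) = p := by
  obtain ⟨c, hc⟩ := h.exists_chart x
  let T' : F × K →L[ℝ] E := mfderiv 𝓘(ℝ, F × K) 𝓘(ℝ, E) c.dom.symm (c.dom x)
  let C : F →L[ℝ] F := mfderiv 𝓘(ℝ, F) 𝓘(ℝ, F) c.cod (π x)
  exact ⟨T'.comp ((ContinuousLinearMap.inl ℝ F K).comp C), fun p => c.mfderiv_lift hc p⟩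

theorem mfderiv_surjective (x : M) (p : F) : ∃ v : TangentSpace 𝓘(ℝ, E) x,
    (mfderiv 𝓘(ℝ, E) 𝓘(ℝ, F) π x v : F) = p :=
  let ⟨s, hs⟩ := h.exists_rightInverse x
  ⟨s p, hs p⟩

variable [CompleteSpace E] [FiniteDimensional ℝ K] [T2Space M]

theorem exists_eq_smul {x : M} {v : TangentSpace 𝓘(ℝ, E) x}
    (hv : (mfderiv 𝓘(ℝ, E) 𝓘(ℝ, F) π x v : F) = 0) : ∃ a : ℝ, v = a • R x :=
  let ⟨c, hc⟩ := h.exists_chart x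
  c.exists_eq_smul_of_mfderiv_eq_zero h.fibre hc (h.reeb.ne_zero x) hv

/-- The form `dη` descends pointwise. -/
theorem exists_descends : ∃ B : M → F [⋀^Fin 2]→L[ℝ] ℝ, ∀ x v w,
    B x ![mfderiv 𝓘(ℝ, E) 𝓘(ℝ, F) π x v, mfderiv 𝓘(ℝ, E) 𝓘(ℝ, F) π x w] = η.d x ![v, w] := by
  choose s hs using h.exists_rightInverse
  refine ⟨fun x => (η.d x : E [⋀^Fin 2]→L[ℝ] ℝ).compContinuousLinearMap (s x), fun x v w => ?_⟩
  let A : E →L[ℝ] F := mfderiv 𝓘(ℝ, E) 𝓘(ℝ, F) π x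
  -- Lifting Tπ(v) recovers `v` up to an element of ker Tπ, that is, a multiple of R, which dη does
  -- not see.
  have hA : ∀ v : TangentSpace 𝓘(ℝ, E) x, ∃ a : ℝ, s x (A v) = v + a • R x := by
    intro v
    let v' : E := v
    have h0 : A (s x (A v') - v') = 0 := by
      rw [map_sub, sub_eq_zero]; exact hs x (A v')
    obtain ⟨a, ha⟩ := h.exists_eq_smul (x := x) h0
    exact ⟨a, by rw [← ha]; exact (add_sub_cancel v' (s x (A v'))).symm⟩
  obtain ⟨a, ha⟩ := hA v
  obtain ⟨b, hb⟩ := hA w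
  refine Eq.trans ?_ (h.reeb.d_add_smul x v w a b)
  rw [← ha, ← hb]
  change (η.d x : E [⋀^Fin 2]→L[ℝ] ℝ) _ = _
  congr 1
  funext i
  fin_cases i <;> rfl

/-- The form `dη` descends to the target. -/
theorem exists_form : ∃ Ω : Form F N 2, Form.pullback π Ω = η.d := by
  obtain ⟨B, hB⟩ := h.exists_descends
  have hBc : ∀ x y, π x = π y → B x = B y := fun x y hxy =>
    ((h.fibre x y).1 hxy).eq_of_locally_eq fun z => by
      obtain ⟨c, hc⟩ := h.exists_chart z
      filter_upwards [c.eventually_eq_of_descends h.contact.smooth hB hc] with z' hz' hzz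
      exact hz' ((h.fibre z z').2 hzz)
  -- By `hBc` the chosen point of the fibre is immaterial.
  refine ⟨fun y => B (Function.surjInv h.surjective y), ?_⟩
  funext x
  ext u
  have hu : u = ![u 0, u 1] := by ext i; fin_cases i <;> rfl
  rw [hu, ← hB x]
  change B (Function.surjInv h.surjective (π x)) _ = _
  rw [hBc _ x (Function.surjInv_eq h.surjective (π x))]
  congr 1
  funext i
  fin_cases i <;> rfl

end IsReebReduction

/-! ### Uniqueness of Ω, and Ω is symplectic -/

section Form

namespace IsReebReduction

variable (h : IsReebReduction (F := F) n K η R π) {Ω : Form F N 2} (hΩ : Form.pullback π Ω = η.d)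
include h hΩ

omit h [IsManifold 𝓘(ℝ, E) ∞ M] in
theorem form_apply (x : M) (v w : TangentSpace 𝓘(ℝ, E) x) :
    Ω (π x) ![mfderiv 𝓘(ℝ, E) 𝓘(ℝ, F) π x v, mfderiv 𝓘(ℝ, E) 𝓘(ℝ, F) π x w] = η.d x ![v, w] := by
  rw [← hΩ]
  change Ω (π x) _ = Ω (π x) _
  congr 1
  funext i
  fin_cases i <;> rfl

/-- π and every Tπ are surjective, so pullback by π is injective on forms. -/
theorem form_unique {Ω' : Form F N 2} (hΩ' : Form.pullback π Ω' = η.d) : Ω = Ω' := by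
  funext y
  obtain ⟨x, rfl⟩ := h.surjective y
  ext u
  have hu : u = ![u 0, u 1] := by ext i; fin_cases i <;> rfl
  obtain ⟨v, hv⟩ := h.mfderiv_surjective x (u 0)
  obtain ⟨w, hw⟩ := h.mfderiv_surjective x (u 1)
  rw [hu, ← hv, ← hw]
  exact (form_apply hΩ x v w).trans (form_apply hΩ' x v w).symm

/-- In every smooth parametrization, `Ω` is locally the exterior derivative of the pullback of `η`
by a lift. -/
theorem exists_eventually_pullback_eq {V : Type*} [NormedAddCommGroup V] [NormedSpace ℝ V]
    {χ : V → N} {z : V} (hχ : ∀ᶠ z' in 𝓝 z, ContMDiffAt 𝓘(ℝ, V) 𝓘(ℝ, F) ∞ χ z') :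
    ∃ τ : V → V [⋀^Fin 1]→L[ℝ] ℝ, ContDiffAt ℝ ∞ τ z ∧
      (Form.pullback χ Ω : V → V [⋀^Fin 2]→L[ℝ] ℝ) =ᶠ[𝓝 z] extDeriv τ := by
  obtain ⟨x, hx⟩ := h.surjective (χ z)
  obtain ⟨σ, hσx, hσ⟩ := h.exists_section x
  rw [hx] at hσ
  have hσχ := hχ.self_of_nhds.continuousAt.eventually hσ.eventually_nhds
  have hg : ∀ᶠ z' in 𝓝 z, ContMDiffAt 𝓘(ℝ, V) 𝓘(ℝ, E) ∞ (σ ∘ χ) z' := by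
    filter_upwards [hχ, hσχ] with z' h1 h2
    exact h2.self_of_nhds.1.comp z' h1
  refine ⟨Form.pullback (σ ∘ χ) η, h.contact.smooth.contDiffAt_pullback hg.self_of_nhds, ?_⟩
  filter_upwards [hχ, hσχ, hg] with z' h1 h2 h3
  -- d((σχ)^*η) = (σχ)^*π^*Ω = (πσχ)^*Ω, and πσχ = χ near `z'`.
  rw [h.contact.smooth.extDeriv_pullback h3, ← hΩ]
  have h4 : π ∘ σ ∘ χ =ᶠ[𝓝 z'] χ := by
    filter_upwards [h1.continuousAt.eventually h2] with z'' h5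
    exact h5.2
  have h5 := mfderiv_comp z' (h.mdifferentiable _) (h3.mdifferentiableAt (by simp))
  rw [h4.mfderiv_eq] at h5
  ext u
  change (Ω (χ z') : F [⋀^Fin 2]→L[ℝ] ℝ) (fun i => mfderiv 𝓘(ℝ, V) 𝓘(ℝ, F) χ z' (u i)) =
    (Ω (π (σ (χ z'))) : F [⋀^Fin 2]→L[ℝ] ℝ) (fun i => mfderiv 𝓘(ℝ, E) 𝓘(ℝ, F) π (σ (χ z'))
      (mfderiv 𝓘(ℝ, V) 𝓘(ℝ, E) (σ ∘ χ) z' (u i)))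
  refine Eq.trans ?_ (Form.apply_congr Ω h2.self_of_nhds.2 _).symm
  congr 1
  funext i
  exact DFunLike.congr_fun h5 (u i)

/-- The form on the space of integral curves is symplectic. -/
theorem isSymplecticForm [FiniteDimensional ℝ E] [CompleteSpace E] [IsManifold 𝓘(ℝ, F) ∞ N]
    [T2Space M] : IsSymplecticForm Ω where
  smooth y z hz := by
    obtain ⟨τ, hτ, hτΩ⟩ := h.exists_eventually_pullback_eq hΩ
      (eventually_contMDiffAt_extChartAt_symm (y := y) hz)
    exact ((contDiffAt_extDeriv hτ).congr_of_eventuallyEq hτΩ).contDiffWithinAt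
  closed y := by
    obtain ⟨τ, hτ, hτΩ⟩ := h.exists_eventually_pullback_eq hΩ
      (eventually_contMDiffAt_extChartAt_symm (mem_extChartAt_target (I := 𝓘(ℝ, F)) y))
    have h1 : extDeriv (Ω.inChart y) (extChartAt 𝓘(ℝ, F) y y) = 0 := by
      refine hτΩ.extDeriv_eq.trans (extDeriv_extDeriv_apply (r := ∞) hτ ?_)
      rw [minSmoothness_of_isRCLikeNormedField]; exact WithTop.coe_le_coe.2 le_top
    rw [Form.d, h1]
    rfl
  nondegenerate y p hp := by
    obtain ⟨x, rfl⟩ := h.surjective y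
    obtain ⟨v, rfl⟩ := h.mfderiv_surjective x p
    -- A lift of a vector in ker Ω lies in ker dη, so it is a multiple of R, which Tπ annihilates.
    have h1 : v = η x ![v] • R x := by
      refine h.contact.eq_smul_reeb h.reeb fun w => ?_
      rw [← form_apply hΩ]
      exact hp _
    have h2 := mfderiv_projection_apply_self (fun x y => (h.fibre x y).2) (h.mdifferentiable x)
    rw [h1]
    refine (map_smul _ _ _).trans ?_
    exact (congrArg (fun q : F => (η x ![v]) • q) h2).trans (smul_zero (A := F) _)

end IsReebReduction
end Form
end ReebReduction

/-! ### Projection of vector fields and Hamiltonian functions -/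

section VectorFields

variable {E : Type*} [NormedAddCommGroup E] [NormedSpace ℝ E]
  {M : Type*} [TopologicalSpace M] [ChartedSpace E M] [IsManifold 𝓘(ℝ, E) ∞ M]
  {F : Type*} [NormedAddCommGroup F] [NormedSpace ℝ F]
  {N : Type*} [TopologicalSpace N] [ChartedSpace F N] [IsManifold 𝓘(ℝ, F) ∞ N]
  {K : Type*} [NormedAddCommGroup K] [NormedSpace ℝ K]
  {n : ℕ} {η : Form E M 1} {R : VectorFields E M} {π : M → N}

omit [IsManifold 𝓘(ℝ, F) ∞ N] in
theorem tangentBundle_mk_congr {y z : N} (h : y = z) (p : F) :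
    (⟨y, p⟩ : TangentBundle 𝓘(ℝ, F) N) = ⟨z, p⟩ := by
  subst h; rfl

theorem IsProjectionOf.apply_of_eq {Z : VectorFields E M} {Y : VectorFields F N}
    (hY : IsProjectionOf π Z Y) {x : M} {y : N} (hxy : π x = y) :
    (mfderiv 𝓘(ℝ, E) 𝓘(ℝ, F) π x (Z x) : F) = Y y := by
  subst hxy; exact hY x

namespace IsReebReduction

variable (h : IsReebReduction (F := F) n K η R π)
include h

theorem projection_unique {Z : VectorFields E M} {Y Y' : VectorFields F N}
    (hY : IsProjectionOf π Z Y) (hY' : IsProjectionOf π Z Y') : Y = Y' := by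
  ext y
  obtain ⟨x, rfl⟩ := h.surjective y
  exact (hY x).symm.trans (hY' x)

/-- Well-definedness is the hypothesis; smoothness holds because near each point the projected field
is Tπ ∘ Z ∘ σ for a local section σ. -/
theorem exists_projection {Z : VectorFields E M} (hZ : ∀ x x', π x = π x' →
    (mfderiv 𝓘(ℝ, E) 𝓘(ℝ, F) π x (Z x) : F) = mfderiv 𝓘(ℝ, E) 𝓘(ℝ, F) π x' (Z x')) :
    ∃ Y : VectorFields F N, IsProjectionOf π Z Y := by
  let Y : N → F := fun y => mfderiv 𝓘(ℝ, E) 𝓘(ℝ, F) π (Function.surjInv h.surjective y)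
    (Z (Function.surjInv h.surjective y))
  have hY : ∀ x, (mfderiv 𝓘(ℝ, E) 𝓘(ℝ, F) π x (Z x) : F) = Y (π x) := fun x =>
    hZ _ _ (Function.surjInv_eq h.surjective (π x)).symm
  refine ⟨⟨Y, fun y => ?_⟩, hY⟩
  obtain ⟨x, rfl⟩ := h.surjective y
  obtain ⟨σ, hσx, hσ⟩ := h.exists_section x
  have h1 : ContMDiffAt 𝓘(ℝ, F) (𝓘(ℝ, F).prod 𝓘(ℝ, F)) ∞
      (fun y => tangentMap 𝓘(ℝ, E) 𝓘(ℝ, F) π ⟨σ y, Z (σ y)⟩) (π x) :=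
    ((h.contMDiff.contMDiff_tangentMap (m := ∞) le_rfl).contMDiffAt).comp _
      (Z.contMDiff.contMDiffAt.comp _ hσ.self_of_nhds.1)
  refine h1.congr_of_eventuallyEq ?_
  filter_upwards [hσ] with y hy
  refine (tangentBundle_mk_congr hy.2.symm (Y y)).trans ?_
  have h2 := hY (σ y)
  rw [hy.2] at h2
  exact congrArg (fun p : F => (⟨π (σ y), p⟩ : TangentBundle 𝓘(ℝ, F) N)) h2.symm

/-- The same local formula Tπ ∘ X ∘ σ, with time as a parameter. -/
theorem isSmoothInTime [CompleteSpace E] [CompleteSpace F] {X : ℝ → VectorFields E M}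
    {Y : ℝ → VectorFields F N}
    (hY : ∀ t, IsProjectionOf π (X t) (Y t)) (hX : IsSmoothInTime X) :
    IsSmoothInTime Y := by
  rintro ⟨t, y⟩
  obtain ⟨x, rfl⟩ := h.surjective y
  obtain ⟨σ, hσx, hσ⟩ := h.exists_section x
  have h0 : ContMDiffAt (𝓘(ℝ, ℝ).prod 𝓘(ℝ, F)) (𝓘(ℝ, ℝ).prod 𝓘(ℝ, E)) ∞
      (fun p : ℝ × N => (p.1, σ p.2)) (t, π x) :=
    contMDiffAt_fst.prodMk (hσ.self_of_nhds.1.comp (t, π x) contMDiffAt_snd)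
  have h1 : ContMDiffAt (𝓘(ℝ, ℝ).prod 𝓘(ℝ, F)) (𝓘(ℝ, F).prod 𝓘(ℝ, F)) ∞
      (fun p : ℝ × N => tangentMap 𝓘(ℝ, E) 𝓘(ℝ, F) π ⟨σ p.2, X p.1 (σ p.2)⟩) (t, π x) :=
    ((h.contMDiff.contMDiff_tangentMap (m := ∞) le_rfl).contMDiffAt).comp _
      (ContMDiffAt.comp (t, π x) (hX.contMDiffAt) h0)
  refine h1.congr_of_eventuallyEq ?_
  filter_upwards [(continuousAt_snd (p := (t, π x))).eventually hσ] with p hp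
  let w : F := Y p.1 p.2
  refine (tangentBundle_mk_congr (F := F) hp.2.symm w).trans ?_
  exact congrArg (fun q : F => (⟨π (σ p.2), q⟩ : TangentBundle 𝓘(ℝ, F) N))
    ((hY p.1).apply_of_eq hp.2).symm

omit [IsManifold 𝓘(ℝ, F) ∞ N] in
/-- A smooth first integral of the Reeb vector field descends to a smooth function. -/
theorem exists_function {f : M → ℝ} (hf : IsSmoothFun (E := E) f)
    (hR : ∀ x, dfun f x (R x) = 0) : ∃ g : N → ℝ, IsSmoothFun (E := F) g ∧ ∀ x, g (π x) = f x := by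
  have hc : ∀ x x', π x = π x' → f x = f x' := fun x x' hx =>
    ((h.fibre x x').1 hx).eq_of_mfderiv_eq_zero (hf.mdifferentiable (by simp)) hR
  have hg : ∀ x, f (Function.surjInv h.surjective (π x)) = f x := fun x =>
    hc _ _ (Function.surjInv_eq h.surjective (π x))
  refine ⟨fun y => f (Function.surjInv h.surjective y), fun y => ?_, hg⟩
  obtain ⟨x, rfl⟩ := h.surjective y
  obtain ⟨σ, hσx, hσ⟩ := h.exists_section x
  refine (hf.contMDiffAt.comp (π x) hσ.self_of_nhds.1).congr_of_eventuallyEq ?_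
  filter_upwards [hσ] with y hy
  rw [Function.comp, ← hg (σ y), hy.2]

variable {Ω : Form F N 2} (hΩ : Form.pullback π Ω = η.d)
include hΩ

omit [IsManifold 𝓘(ℝ, F) ∞ N] in
/-- A contact Hamiltonian vector field whose Hamiltonian function is a first integral of the Reeb
vector field projects pointwise to Hamiltonian vectors. -/
theorem exists_hamiltonian {Z : VectorFields E M} {f : M → ℝ} (hZ : IsContactHamiltonian η R Z f)
    (hR : ∀ x, dfun f x (R x) = 0) : ∃ g : N → ℝ, IsSmoothFun (E := F) g ∧
      ∀ x p, Ω (π x) ![mfderiv 𝓘(ℝ, E) 𝓘(ℝ, F) π x (Z x), p] = dfun g (π x) p := by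
  obtain ⟨g, hg, hgf⟩ := h.exists_function hZ.smooth hR
  refine ⟨g, hg, fun x p => ?_⟩
  obtain ⟨v, rfl⟩ := h.mfderiv_surjective x p
  have h1 : g ∘ π = f := funext hgf
  have h2 := mfderiv_comp x (hg.mdifferentiable (by simp) (π x)) (h.mdifferentiable x)
  rw [h1] at h2
  have h3 : dfun f x v = dfun g (π x) (mfderiv 𝓘(ℝ, E) 𝓘(ℝ, F) π x v) := DFunLike.congr_fun h2 v
  refine (form_apply hΩ x (Z x) v).trans ?_
  rw [hZ.contract_d, hR, zero_mul, sub_zero, h3]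

/-- Both vectors are Ω-dual to the same covector dg at the common image point, so nondegeneracy
identifies them. This avoids showing that [R, Z] is tangent to the fibres. -/
theorem mfderiv_eq_of_contactHamiltonian [FiniteDimensional ℝ E] [CompleteSpace E] [T2Space M]
    {Z : VectorFields E M} {f : M → ℝ} (hZ : IsContactHamiltonian η R Z f)
    (hR : ∀ x, dfun f x (R x) = 0) (x x' : M) (hx : π x = π x') :
    (mfderiv 𝓘(ℝ, E) 𝓘(ℝ, F) π x (Z x) : F) = mfderiv 𝓘(ℝ, E) 𝓘(ℝ, F) π x' (Z x') := by
  obtain ⟨g, hg, hgΩ⟩ := h.exists_hamiltonian hΩ hZ hR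
  let β : F [⋀^Fin 2]→L[ℝ] ℝ := Ω (π x)
  let p : F := mfderiv 𝓘(ℝ, E) 𝓘(ℝ, F) π x (Z x)
  let p' : F := mfderiv 𝓘(ℝ, E) 𝓘(ℝ, F) π x' (Z x')
  let dg : F →L[ℝ] ℝ := mfderiv 𝓘(ℝ, F) 𝓘(ℝ, ℝ) g (π x)
  have h1 : ∀ q : F, β ![p, q] = dg q := fun q => hgΩ x q
  have h2 : ∀ q : F, β ![p', q] = dg q := fun q =>
    (Form.apply_congr Ω hx _).trans ((hgΩ x' q).trans (mfderiv_congr_base g hx q).symm)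
  have h3 : ∀ q : F, β ![p - p', q] = 0 := by
    intro q
    have h4 := β.map_update_sub ![p, q] 0 p p'
    simp only [Matrix.vecCons, Fin.update_cons_zero] at h4 h1 h2 ⊢
    rw [h4, h1, h2, sub_self]
  exact sub_eq_zero.1 ((h.isSymplecticForm hΩ).nondegenerate (π x) (p - p') h3)

theorem exists_projection_of_contactHamiltonian [FiniteDimensional ℝ E] [CompleteSpace E]
    [T2Space M] {Z : VectorFields E M} {f : M → ℝ} (hZ : IsContactHamiltonian η R Z f)
    (hR : ∀ x, dfun f x (R x) = 0) : ∃ Y : VectorFields F N, IsProjectionOf π Z Y :=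
  h.exists_projection (h.mfderiv_eq_of_contactHamiltonian hΩ hZ hR)

theorem isHamiltonianField {Z : VectorFields E M} {f : M → ℝ} (hZ : IsContactHamiltonian η R Z f)
    (hR : ∀ x, dfun f x (R x) = 0) {Y : VectorFields F N} (hY : IsProjectionOf π Z Y) :
    IsHamiltonianField Ω Y := by
  obtain ⟨g, hg, hgΩ⟩ := h.exists_hamiltonian hΩ hZ hR
  refine ⟨g, hg, fun y p => ?_⟩
  obtain ⟨x, rfl⟩ := h.surjective y
  rw [← hgΩ x p, hY x]

end IsReebReduction

end VectorFields

/-! ### Brackets of related vector fields -/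

/-- The Lie brackets of related vector fields are related. -/
theorem fderiv_lieBracket_of_related {E F : Type*} [NormedAddCommGroup E] [NormedSpace ℝ E]
    [NormedAddCommGroup F] [NormedSpace ℝ F] {f : E → F} {V W : E → E} {V' W' : F → F} {z : E}
    (hf : ContDiffAt ℝ ∞ f z) (hV : DifferentiableAt ℝ V z) (hW : DifferentiableAt ℝ W z)
    (hV' : DifferentiableAt ℝ V' (f z)) (hW' : DifferentiableAt ℝ W' (f z))
    (hVV : ∀ᶠ y in 𝓝 z, fderiv ℝ f y (V y) = V' (f y))
    (hWW : ∀ᶠ y in 𝓝 z, fderiv ℝ f y (W y) = W' (f y)) :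
    fderiv ℝ f z (VectorField.lieBracket ℝ V W z) = VectorField.lieBracket ℝ V' W' (f z) := by
  have h2 : minSmoothness ℝ 2 ≤ ∞ := by
    rw [minSmoothness_of_isRCLikeNormedField]; exact WithTop.coe_le_coe.2 le_top
  have hd := hf.differentiableAt (by simp)
  rw [VectorField.fderiv_apply_lieBracket hf h2 hW hV]
  -- Relatedness holds on a neighbourhood, so it may be differentiated by the chain rule.
  have e1 : fderiv ℝ (fun y => fderiv ℝ f y (W y)) z = (fderiv ℝ W' (f z)).comp (fderiv ℝ f z) := by
    rw [Filter.EventuallyEq.fderiv_eq hWW]; exact fderiv_comp z hW' hd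
  have e2 : fderiv ℝ (fun y => fderiv ℝ f y (V y)) z = (fderiv ℝ V' (f z)).comp (fderiv ℝ f z) := by
    rw [Filter.EventuallyEq.fderiv_eq hVV]; exact fderiv_comp z hV' hd
  rw [e1, e2, ContinuousLinearMap.comp_apply, ContinuousLinearMap.comp_apply,
    hVV.self_of_nhds, hWW.self_of_nhds, VectorField.lieBracket_eq]

section Bracket

variable {E : Type*} [NormedAddCommGroup E] [NormedSpace ℝ E] [CompleteSpace E]
  {M : Type*} [TopologicalSpace M] [ChartedSpace E M] [IsManifold 𝓘(ℝ, E) ∞ M]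
  {F : Type*} [NormedAddCommGroup F] [NormedSpace ℝ F] [CompleteSpace F]
  {N : Type*} [TopologicalSpace N] [ChartedSpace F N] [IsManifold 𝓘(ℝ, F) ∞ N]

/-- The coordinate expression of a vector field in the preferred chart at `x₀`. -/
def chartField (X : VectorFields E M) (x₀ : M) : E → E :=
  VectorField.mpullbackWithin 𝓘(ℝ, E) 𝓘(ℝ, E) (extChartAt 𝓘(ℝ, E) x₀).symm X
    (Set.range 𝓘(ℝ, E))

/-- The preferred chart at `x` has identity derivative at `x`, so no correction appears when the
bracket is computed in it. -/
theorem bracket_apply_eq_lieBracket (X X' : VectorFields E M) (x : M) :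
    ((⁅X, X'⁆ : VectorFields E M) x : E) =
      VectorField.lieBracket ℝ (chartField X x) (chartField X' x) (extChartAt 𝓘(ℝ, E) x x) := by
  rw [bracket_apply, ← VectorField.mlieBracketWithin_univ, VectorField.mlieBracketWithin_apply,
    mfderiv_extChartAt_self]
  have hr : (extChartAt 𝓘(ℝ, E) x).symm ⁻¹' Set.univ ∩ Set.range 𝓘(ℝ, E) = Set.univ := by simp
  rw [hr]
  change (ContinuousLinearMap.id ℝ E).inverse (VectorField.lieBracketWithin ℝ (chartField X x)
    (chartField X' x) Set.univ (extChartAt 𝓘(ℝ, E) x x)) = _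
  rw [ContinuousLinearMap.inverse_id, VectorField.lieBracketWithin_univ]
  rfl

theorem differentiableAt_chartField (X : VectorFields E M) (x : M) :
    DifferentiableAt ℝ (chartField X x) (extChartAt 𝓘(ℝ, E) x x) := by
  have : IsManifold 𝓘(ℝ, E) 2 M :=
    IsManifold.of_le (n := ∞) (WithTop.coe_le_coe.2 le_top)
  have h := MDifferentiableWithinAt.differentiableWithinAt_mpullbackWithin_vectorField
    (s := Set.univ) (X.mdifferentiable x).mdifferentiableWithinAt
  exact h.differentiableAt (by simp)

omit [CompleteSpace E] in
-- `chartField` inverts the derivative of the inverse chart, which amounts to pushing forward by the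
-- chart itself.
theorem chartField_extChartAt (X : VectorFields E M) {x₀ x : M}
    (hx : x ∈ (extChartAt 𝓘(ℝ, E) x₀).source) :
    chartField X x₀ (extChartAt 𝓘(ℝ, E) x₀ x) =
      mfderiv 𝓘(ℝ, E) 𝓘(ℝ, E) (extChartAt 𝓘(ℝ, E) x₀) x (X x) := by
  have : IsManifold 𝓘(ℝ, E) 1 M := IsManifold.of_le (n := ∞) (by exact_mod_cast le_top)
  let A : E →L[ℝ] E := mfderivWithin 𝓘(ℝ, E) 𝓘(ℝ, E) (extChartAt 𝓘(ℝ, E) x₀).symm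
    (Set.range 𝓘(ℝ, E)) (extChartAt 𝓘(ℝ, E) x₀ x)
  let B : E →L[ℝ] E := mfderiv 𝓘(ℝ, E) 𝓘(ℝ, E) (extChartAt 𝓘(ℝ, E) x₀) x
  have hBA : B.comp A = ContinuousLinearMap.id ℝ E :=
    mfderiv_extChartAt_comp_mfderivWithin_extChartAt_symm' hx
  have hAB : A.comp B = ContinuousLinearMap.id ℝ E :=
    mfderivWithin_extChartAt_symm_comp_mfderiv_extChartAt' hx
  have hinv : A.inverse = B := ContinuousLinearMap.inverse_eq hAB hBA
  have hX : ∀ p q : M, p = q → (X p : E) = X q := by rintro p _ rfl; rfl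
  change A.inverse (X ((extChartAt 𝓘(ℝ, E) x₀).symm (extChartAt 𝓘(ℝ, E) x₀ x)) : E) = B (X x)
  rw [hinv, hX _ _ ((extChartAt 𝓘(ℝ, E) x₀).left_inv hx)]

/-- In the charts at `x` and `π x` the coordinate fields are related by the coordinate expression of
π near the base point, which reduces the claim to vector spaces. -/
theorem IsProjectionOf.bracket {π : M → N} (hπ : ContMDiff 𝓘(ℝ, E) 𝓘(ℝ, F) ∞ π)
    {X X' : VectorFields E M} {Y Y' : VectorFields F N} (h : IsProjectionOf π X Y)
    (h' : IsProjectionOf π X' Y') : IsProjectionOf π ⁅X, X'⁆ ⁅Y, Y'⁆ := by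
  intro x
  let f : E → F := writtenInExtChartAt 𝓘(ℝ, E) 𝓘(ℝ, F) x π
  have hf : ContDiffAt ℝ ∞ f (extChartAt 𝓘(ℝ, E) x x) := by
    have := (contMDiffAt_iff.1 (hπ x)).2
    exact this.contDiffAt (by simp)
  have hfx : f (extChartAt 𝓘(ℝ, E) x x) = extChartAt 𝓘(ℝ, F) (π x) (π x) := by
    simp [f, writtenInExtChartAt]
  have hrel : ∀ (X : VectorFields E M) (Y : VectorFields F N), IsProjectionOf π X Y →
      ∀ᶠ z in 𝓝 (extChartAt 𝓘(ℝ, E) x x), fderiv ℝ f z (chartField X x z) =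
        chartField Y (π x) (f z) := by
    intro X Y hXY
    let φ := extChartAt 𝓘(ℝ, E) x
    let ψ := extChartAt 𝓘(ℝ, F) (π x)
    have hπφ : ∀ᶠ p in 𝓝 x, p ∈ φ.source ∧ π p ∈ ψ.source ∧ ContDiffAt ℝ 1 f (φ p) ∧
        f ∘ φ =ᶠ[𝓝 p] ψ ∘ π := by
      have h1 : ∀ᶠ p in 𝓝 x, p ∈ φ.source := extChartAt_source_mem_nhds x
      have h2 : ∀ᶠ p in 𝓝 x, π p ∈ ψ.source :=
        hπ.continuous.continuousAt.eventually (extChartAt_source_mem_nhds (π x))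
      have h3 : ∀ᶠ p in 𝓝 x, ContDiffAt ℝ 1 f (φ p) :=
        (continuousAt_extChartAt x).eventually
          ((hf.of_le (by exact_mod_cast le_top)).eventually (by simp))
      filter_upwards [h1.eventually_nhds, h2, h3] with p hp hp2 hp3
      refine ⟨hp.self_of_nhds, hp2, hp3, ?_⟩
      filter_upwards [hp] with q hq
      change ψ (π (φ.symm (φ q))) = ψ (π q)
      rw [φ.left_inv hq]
    have hz : ∀ᶠ z in 𝓝 (φ x), z ∈ φ.target := extChartAt_target_mem_nhds x
    have hc : Filter.Tendsto φ.symm (𝓝 (φ x)) (𝓝 x) := by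
      simpa [φ] using (continuousAt_extChartAt_symm (I := 𝓘(ℝ, E)) x).tendsto
    filter_upwards [hz, hc.eventually hπφ] with z hz ⟨hp, hpψ, hfp, he⟩
    obtain ⟨p, hpz⟩ : ∃ p, p = φ.symm z := ⟨_, rfl⟩
    rw [← hpz] at hp hpψ hfp he
    obtain rfl : φ p = z := by rw [hpz, φ.right_inv hz]
    have hφp : MDifferentiableAt 𝓘(ℝ, E) 𝓘(ℝ, E) φ p :=
      mdifferentiableAt_extChartAt (by simpa [φ] using hp)
    have hψp : MDifferentiableAt 𝓘(ℝ, F) 𝓘(ℝ, F) ψ (π p) :=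
      mdifferentiableAt_extChartAt (by simpa [ψ] using hpψ)
    have d1 := mfderiv_comp p (hfp.differentiableAt (by simp)).mdifferentiableAt hφp
    have d2 := mfderiv_comp p hψp (hπ.mdifferentiable (by simp) p)
    rw [he.mfderiv_eq, d2, mfderiv_eq_fderiv] at d1
    have hfφ : f (φ p) = ψ (π p) := he.self_of_nhds
    rw [hfφ, chartField_extChartAt X hp, chartField_extChartAt Y hpψ, ← hXY p]
    exact (DFunLike.congr_fun d1 (X p)).symm
  have hmf : (mfderiv 𝓘(ℝ, E) 𝓘(ℝ, F) π x : E →L[ℝ] F) =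
      fderiv ℝ f (extChartAt 𝓘(ℝ, E) x x) := by
    rw [MDifferentiableAt.mfderiv (hπ.mdifferentiable (by simp) x)]
    simp only [modelWithCornersSelf_coe, Set.range_id, fderivWithin_univ]
    rfl
  have key := fderiv_lieBracket_of_related hf (differentiableAt_chartField X x)
    (differentiableAt_chartField X' x)
    (by rw [hfx]; exact differentiableAt_chartField Y (π x))
    (by rw [hfx]; exact differentiableAt_chartField Y' (π x)) (hrel X Y h) (hrel X' Y' h')
  rw [hfx, ← bracket_apply_eq_lieBracket, ← bracket_apply_eq_lieBracket, ← hmf] at key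
  exact key

end Bracket

/-! ### The projected Lie algebra and the Lie–Hamilton property -/

section LieHamilton

variable {E : Type*} [NormedAddCommGroup E] [NormedSpace ℝ E] [FiniteDimensional ℝ E]
  [CompleteSpace E]
  {M : Type*} [TopologicalSpace M] [T2Space M] [ChartedSpace E M] [IsManifold 𝓘(ℝ, E) ∞ M]
  {F : Type*} [NormedAddCommGroup F] [NormedSpace ℝ F] [CompleteSpace F]
  {N : Type*} [TopologicalSpace N] [ChartedSpace F N] [IsManifold 𝓘(ℝ, F) ∞ N]
  {K : Type*} [NormedAddCommGroup K] [NormedSpace ℝ K]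
  {n : ℕ} {η : Form E M 1} {R : VectorFields E M} {π : M → N} {X : ℝ → VectorFields E M}

omit [FiniteDimensional ℝ E] [CompleteSpace E] [T2Space M] [CompleteSpace F] in
theorem IsProjectionOf.add {Z Z' : VectorFields E M} {Y Y' : VectorFields F N}
    (h : IsProjectionOf π Z Y) (h' : IsProjectionOf π Z' Y') :
    IsProjectionOf π (Z + Z') (Y + Y') := by
  intro x
  change mfderiv 𝓘(ℝ, E) 𝓘(ℝ, F) π x (Z x + Z' x) = Y (π x) + Y' (π x)
  rw [map_add, h x, h' x]

omit [FiniteDimensional ℝ E] [CompleteSpace E] [T2Space M] [CompleteSpace F] in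
theorem IsProjectionOf.smul (c : ℝ) {Z : VectorFields E M} {Y : VectorFields F N}
    (h : IsProjectionOf π Z Y) : IsProjectionOf π (c • Z) (c • Y) := by
  intro x
  change mfderiv 𝓘(ℝ, E) 𝓘(ℝ, F) π x (c • Z x) = c • Y (π x)
  rw [map_smul, h x]

omit [FiniteDimensional ℝ E] [CompleteSpace E] [T2Space M] [CompleteSpace F] in
theorem IsProjectionOf.zero : IsProjectionOf π (0 : VectorFields E M) (0 : VectorFields F N) :=
  fun x => map_zero (mfderiv 𝓘(ℝ, E) 𝓘(ℝ, F) π x)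

/-- The projections of the elements of a Lie algebra of vector fields. -/
def projectedLieAlgebra (hπ : ContMDiff 𝓘(ℝ, E) 𝓘(ℝ, F) ∞ π)
    (V : LieSubalgebra ℝ (VectorFields E M)) : LieSubalgebra ℝ (VectorFields F N) where
  carrier := {Y | ∃ Z ∈ V, IsProjectionOf π Z Y}
  add_mem' := by
    rintro _ _ ⟨Z, hZ, h⟩ ⟨Z', hZ', h'⟩
    exact ⟨Z + Z', V.add_mem hZ hZ', h.add h'⟩
  zero_mem' := ⟨0, V.zero_mem, .zero⟩
  smul_mem' := by
    rintro c _ ⟨Z, hZ, h⟩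
    exact ⟨c • Z, V.smul_mem c hZ, h.smul c⟩
  lie_mem' := by
    rintro _ _ ⟨Z, hZ, h⟩ ⟨Z', hZ', h'⟩
    exact ⟨⁅Z, Z'⁆, V.lie_mem hZ hZ', h.bracket hπ h'⟩

namespace IsReebReduction

variable (h : IsReebReduction (F := F) n K η R π)
include h

omit [FiniteDimensional ℝ E] [T2Space M] in
-- Uniqueness of projections makes Z ↦ π_*Z linear on `V`, and its range contains the projected
-- algebra.
theorem finiteDimensional_projectedLieAlgebra {V : LieSubalgebra ℝ (VectorFields E M)}
    [FiniteDimensional ℝ V] (hV : ∀ Z ∈ V, ∃ Y : VectorFields F N, IsProjectionOf π Z Y) :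
    FiniteDimensional ℝ (projectedLieAlgebra (F := F) h.contMDiff V) := by
  choose! P hP using hV
  let L : V →ₗ[ℝ] VectorFields F N :=
    { toFun := fun Z => P Z
      map_add' := fun Z Z' => h.projection_unique (hP _ (Z + Z').2)
        ((hP _ Z.2).add (hP _ Z'.2))
      map_smul' := fun c Z => h.projection_unique (hP _ (c • Z).2) ((hP _ Z.2).smul c) }
  refine Submodule.finiteDimensional_of_le (S₂ := LinearMap.range L)
    (S₁ := (projectedLieAlgebra (F := F) h.contMDiff V).toSubmodule) ?_
  rintro Y ⟨Z, hZ, hY⟩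
  exact ⟨⟨Z, hZ⟩, h.projection_unique (hP Z hZ) hY⟩

variable {Ω : Form F N 2} (hΩ : Form.pullback π Ω = η.d)
include hΩ

omit [CompleteSpace F] in
theorem exists_projection_of_mem (hX : IsConservativeContactLieSystem n η R X)
    {Z : VectorFields E M} (hZ : Z ∈ smallestLieAlgebra X) :
    ∃ Y : VectorFields F N, IsProjectionOf π Z Y := by
  obtain ⟨f, hf⟩ := hX.hamiltonian Z hZ
  exact h.exists_projection_of_contactHamiltonian hΩ hf (hX.conservative Z hZ f hf)

/-- A conservative contact Lie system projects to a Lie-Hamilton system. -/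
theorem isLieHamiltonSystem (hX : IsConservativeContactLieSystem n η R X)
    {Y : ℝ → VectorFields F N} (hY : ∀ t, IsProjectionOf π (X t) (Y t)) :
    IsLieHamiltonSystem Ω Y := by
  have : FiniteDimensional ℝ (smallestLieAlgebra X) := hX.lie
  have hV := h.finiteDimensional_projectedLieAlgebra (V := smallestLieAlgebra X)
    fun Z hZ => h.exists_projection_of_mem hΩ hX hZ
  have hmem : ∀ t, Y t ∈ projectedLieAlgebra (F := F) h.contMDiff (smallestLieAlgebra X) :=
    fun t => ⟨X t, LieSubalgebra.subset_lieSpan ⟨t, rfl⟩, hY t⟩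
  refine ⟨h.isSymplecticForm hΩ, ?_, _, hV, hmem, ?_⟩
  -- The smallest Lie algebra of `Y` lies in the projection of V^X, which contains every `Y t`.
  · refine Submodule.finiteDimensional_of_le (S₁ := (smallestLieAlgebra Y).toSubmodule)
      (S₂ := (projectedLieAlgebra (F := F) h.contMDiff (smallestLieAlgebra X)).toSubmodule) ?_
    refine LieSubalgebra.lieSpan_le.2 ?_
    rintro _ ⟨t, rfl⟩
    exact hmem t
  · rintro W ⟨Z, hZ, hW⟩
    obtain ⟨f, hf⟩ := hX.hamiltonian Z hZ
    exact h.isHamiltonianField hΩ hf (hX.conservative Z hZ f hf) hW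

end IsReebReduction

end LieHamilton
end ContactLie
end

/-! ### The proposition -/

open ContactLie
theorem mainTheorem3
    {E : Type*} [NormedAddCommGroup E] [NormedSpace ℝ E] [FiniteDimensional ℝ E] [CompleteSpace E]
    {M : Type*} [TopologicalSpace M] [T2Space M] [SecondCountableTopology M] [ConnectedSpace M]
    [ChartedSpace E M] [IsManifold 𝓘(ℝ, E) ∞ M]
    (n : ℕ) (η : Form E M 1) (R : VectorFields E M) (X : ℝ → VectorFields E M)
    (hX : IsConservativeContactLieSystem n η R X)
    {F : Type*} [NormedAddCommGroup F] [NormedSpace ℝ F] [FiniteDimensional ℝ F] [CompleteSpace F]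
    [ChartedSpace F (IntegralCurveSpace R)] [IsManifold 𝓘(ℝ, F) ∞ (IntegralCurveSpace R)]
    [T2Space (IntegralCurveSpace R)]
    (hπ : Manifold.IsSubmersion 𝓘(ℝ, E) 𝓘(ℝ, F) ∞ (projection R)) :
    (∃! Ω : Form F (IntegralCurveSpace R) 2, Form.pullback (projection R) Ω = η.d) ∧
    (∃! Y : ℝ → VectorFields F (IntegralCurveSpace R),
      ∀ t, IsProjectionOf (projection R) (X t) (Y t)) ∧
    ∀ (Ω : Form F (IntegralCurveSpace R) 2) (Y : ℝ → VectorFields F (IntegralCurveSpace R)),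
      Form.pullback (projection R) Ω = η.d →
      (∀ t, IsProjectionOf (projection R) (X t) (Y t)) →
      IsSymplecticForm Ω ∧ IsLieHamiltonSystem Ω Y ∧ (IsSmoothInTime X → IsSmoothInTime Y) := by
  obtain ⟨K, _, _, hK⟩ := hπ
  -- At any point of M the submersion provides an isomorphism of E with F × K, so K is a quotient of
  -- E.
  have : FiniteDimensional ℝ K := by
    obtain ⟨x⟩ : Nonempty M := inferInstance
    exact Module.Finite.of_surjective
      ((LinearMap.snd ℝ F K).comp (hK x).equiv.toLinearEquiv.toLinearMap)
      (Prod.snd_surjective.comp (hK x).equiv.surjective)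
  have h : IsReebReduction (F := F) n K η R (projection R) :=
    ⟨hX.contact, hX.reeb, hK, Quotient.mk_surjective, fun _ _ => Quotient.eq⟩
  obtain ⟨Ω, hΩ⟩ := h.exists_form
  choose Y hY using fun t => h.exists_projection_of_mem hΩ hX
    (LieSubalgebra.subset_lieSpan (Set.mem_range_self t) : X t ∈ smallestLieAlgebra X)
  refine ⟨⟨Ω, hΩ, fun Ω' hΩ' => h.form_unique hΩ' hΩ⟩,
    ⟨Y, hY, fun Y' hY' => funext fun t => h.projection_unique (hY' t) (hY t)⟩,
    fun Ω' Y' hΩ' hY' => ⟨h.isSymplecticForm hΩ', h.isLieHamiltonSystem hΩ' hX hY',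
      h.isSmoothInTime hY'⟩⟩
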